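/- Let $d\geq 2$ and $n=d^2+5d+5$. All subscripts of the vertices $a_i$ are read modulo $n$. Let $\mathcal M^{d+1}_n$ be the simplicial complex on the vertex set $\{a_0,\dots,a_{n-1}\}$ whose facets are, for $0\le i\le n-1$ and $1\le k\le d$, $$\sigma_i=\{a_{i-j}:0\le j\le d+1\},\qquad \mu_i=\{a_i\}\cup\{a_{i+j(d+3)-1}:1\le j\le d+1\},$$ $$\alpha_{k,i}=\{a_i\}\cup\{a_{i-j}:2\le j\le d+2-k\}\cup\{a_{i+j(d+3)-1}:1\le j\le k\},$$ and let $\mathcal N^{d+1}_n$ be the simplicial complex on the same vertex set whose facets are, for the same $i$ and $k$, $$\sigma_i=\{a_{i-j}:0\le j\le d+1\},\qquad \mu_i=\{a_{i-j(d+3)}:0\le j\le d+1\},$$ $$\alpha_{k,i}=\{a_i\}\cup\{a_{i-j}:2\le j\le d+2-k\}\cup\{a_{i-j(d+3)}:2\le j\le k+1\}.$$ Both complexes are pure of dimension $d+1$. For $\mathcal X\in\{\mathcal M^{d+1}_n,\mathcal N^{d+1}_n\}$ let $\partial\mathcal X$ be the pure $d$-dimensional subcomplex whose facets are the $d$-dimensional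 faces of $\mathcal X$ contained in exactly one facet of $\mathcal X$, and put $M^d_n=\partial\mathcal M^{d+1}_n$ and $N^d_n=\partial\mathcal N^{d+1}_n$. For a simplicial complex $X$, let $\mathrm{Aut}(X)$ be the group of permutations of its vertex set that map faces to faces and non-faces to non-faces. Let $\psi=(a_0,a_1,\dots,a_{n-1})$ be the $n$-cycle $a_i\mapsto a_{i+1}$. Then $$\mathrm{Aut}(M^d_n)=\mathrm{Aut}(\mathcal M^{d+1}_n)=\langle\psi\rangle=\mathrm{Aut}(\mathcal N^{d+1}_n)=\mathrm{Aut}(N^d_n)\cong\mathbb Z_n .$$ -/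

import Mathlib

/-! Finite abstract simplicial complexes on a vertex type `V` are Mathlib's
`PreAbstractSimplicialComplex V`: downward closed families of nonempty finite subsets of `V`. -/

namespace CyclicManifold

section General

variable {V : Type*}

/-- The simplicial complex generated by a family `F` of finite sets: its faces are the nonempty
subsets of the members of `F`. -/
def generated (F : Set (Finset V)) : PreAbstractSimplicialComplex V where
  faces := {s | s.Nonempty ∧ ∃ t ∈ F, s ⊆ t}
  isRelLowerSet_faces := by
    rintro s ⟨hs, t, ht, hst⟩
    exact ⟨hs, fun u hu hne => ⟨hne, t, ht, Finset.Subset.trans hu hst⟩⟩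

/-- A facet of `X` is a maximal face. -/
def IsFacet (X : PreAbstractSimplicialComplex V) (s : Finset V) : Prop :=
  s ∈ X.faces ∧ ∀ t ∈ X.faces, s ⊆ t → t = s

/-- The faces of `X` that lie in exactly one facet of `X` and have codimension one in it. In a pure
complex of dimension `m` these are the `(m - 1)`-dimensional faces contained in a unique facet. -/
def boundaryFacets (X : PreAbstractSimplicialComplex V) : Set (Finset V) :=
  {t | t ∈ X.faces ∧ ∃ s, IsFacet X s ∧ t ⊆ s ∧ s.card = t.card + 1 ∧
    ∀ s', IsFacet X s' → t ⊆ s' → s' = s}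

/-- The boundary `∂X` of a weak pseudomanifold `X`: the subcomplex generated by the codimension-one
faces which are contained in a unique facet. -/
def boundary (X : PreAbstractSimplicialComplex V) : PreAbstractSimplicialComplex V :=
  generated (boundaryFacets X)

/-- The automorphism group of `X`: the permutations of the vertex set of `X` which carry faces to
faces and non-faces to non-faces. A permutation of the vertex set `{v | {v} ∈ X.faces}` is
represented by its extension to `V` by the identity. -/
def Aut (X : PreAbstractSimplicialComplex V) : Subgroup (Equiv.Perm V) where
  carrier := {g | (∀ v, {v} ∉ X.faces → g v = v) ∧
    ∀ s : Finset V, s.map g.toEmbedding ∈ X.faces ↔ s ∈ X.faces}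
  one_mem' := by
    refine ⟨fun v _ => rfl, fun s => ?_⟩
    have h : s.map (1 : Equiv.Perm V).toEmbedding = s := by
      ext x; simp only [Finset.mem_map]; simp
    rw [h]
  mul_mem' := by
    rintro f g ⟨hf, hf'⟩ ⟨hg, hg'⟩
    refine ⟨fun v hv => ?_, fun s => ?_⟩
    · rw [Equiv.Perm.mul_apply, hg v hv, hf v hv]
    · have h : s.map (f * g).toEmbedding = (s.map g.toEmbedding).map f.toEmbedding := by
        rw [Finset.map_map]; rfl
      rw [h, hf', hg']
  inv_mem' := by
    rintro f ⟨hf, hf'⟩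
    refine ⟨fun v hv => ?_, fun s => ?_⟩
    · rw [Equiv.Perm.inv_eq_iff_eq, hf v hv]
    · have h : (s.map (f⁻¹).toEmbedding).map f.toEmbedding = s := by
        ext x; simp only [Finset.mem_map]; simp
      rw [← hf', h]

end General

/-- The number of vertices, `n = d² + 5d + 5`. -/
abbrev vertexCount (d : ℕ) : ℕ := d ^ 2 + 5 * d + 5

/-- The vertex set `{a_0, …, a_{n-1}}`, with the vertex `a_i` written as the residue `i` modulo `n`,
so that subscripts are read modulo `n`. -/
abbrev Vertex (d : ℕ) : Type := ZMod (vertexCount d)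

/-- `σ_i = {a_{i-j} : 0 ≤ j ≤ d+1}` (the same sets occur in both families). -/
def sigma (d : ℕ) (i : Vertex d) : Finset (Vertex d) :=
  (Finset.Icc 0 (d + 1)).image fun j : ℕ => i - (j : Vertex d)

/-- First family: `μ_i = {a_i} ∪ {a_{i+j(d+3)-1} : 1 ≤ j ≤ d+1}`. -/
def muM (d : ℕ) (i : Vertex d) : Finset (Vertex d) :=
  {i} ∪ (Finset.Icc 1 (d + 1)).image fun j : ℕ => i + (j : Vertex d) * ((d : Vertex d) + 3) - 1

/-- First family: `α_{k,i} = {a_i} ∪ {a_{i-j} : 2 ≤ j ≤ d+2-k} ∪ {a_{i+j(d+3)-1} : 1 ≤ j ≤ k}`,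
used for `1 ≤ k ≤ d`. -/
def alphaM (d k : ℕ) (i : Vertex d) : Finset (Vertex d) :=
  {i} ∪ ((Finset.Icc 2 (d + 2 - k)).image fun j : ℕ => i - (j : Vertex d)) ∪
    ((Finset.Icc 1 k).image fun j : ℕ => i + (j : Vertex d) * ((d : Vertex d) + 3) - 1)

/-- Second family: `μ_i = {a_{i-j(d+3)} : 0 ≤ j ≤ d+1}`. -/
def muN (d : ℕ) (i : Vertex d) : Finset (Vertex d) :=
  (Finset.Icc 0 (d + 1)).image fun j : ℕ => i - (j : Vertex d) * ((d : Vertex d) + 3)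

/-- Second family: `α_{k,i} = {a_i} ∪ {a_{i-j} : 2 ≤ j ≤ d+2-k} ∪ {a_{i-j(d+3)} : 2 ≤ j ≤ k+1}`,
used for `1 ≤ k ≤ d`. -/
def alphaN (d k : ℕ) (i : Vertex d) : Finset (Vertex d) :=
  {i} ∪ ((Finset.Icc 2 (d + 2 - k)).image fun j : ℕ => i - (j : Vertex d)) ∪
    ((Finset.Icc 2 (k + 1)).image fun j : ℕ => i - (j : Vertex d) * ((d : Vertex d) + 3))

/-- The list of facets of `𝓜^{d+1}_n`. -/
def facetsM (d : ℕ) : Set (Finset (Vertex d)) :=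
  {s | (∃ i, s = sigma d i) ∨ (∃ i, s = muM d i) ∨
    ∃ k i, 1 ≤ k ∧ k ≤ d ∧ s = alphaM d k i}

/-- The list of facets of `𝓝^{d+1}_n`. -/
def facetsN (d : ℕ) : Set (Finset (Vertex d)) :=
  {s | (∃ i, s = sigma d i) ∨ (∃ i, s = muN d i) ∨
    ∃ k i, 1 ≤ k ∧ k ≤ d ∧ s = alphaN d k i}

/-- The `(d+1)`-dimensional complex `𝓜^{d+1}_n`. -/
def calM (d : ℕ) : PreAbstractSimplicialComplex (Vertex d) := generated (facetsM d)

/-- The `(d+1)`-dimensional complex `𝓝^{d+1}_n`. -/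
def calN (d : ℕ) : PreAbstractSimplicialComplex (Vertex d) := generated (facetsN d)

/-- The `d`-dimensional complex `M^d_n = ∂𝓜^{d+1}_n`. -/
def bdM (d : ℕ) : PreAbstractSimplicialComplex (Vertex d) := boundary (calM d)

/-- The `d`-dimensional complex `N^d_n = ∂𝓝^{d+1}_n`. -/
def bdN (d : ℕ) : PreAbstractSimplicialComplex (Vertex d) := boundary (calN d)

/-- The `n`-cycle `ψ = (a_0, a_1, …, a_{n-1})`, i.e. `a_i ↦ a_{i+1}`. -/
def psi (d : ℕ) : Equiv.Perm (Vertex d) := Equiv.addRight 1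

end CyclicManifold

/-! Since n = (d+3)(d+2) - 1, the map (a, b) ↦ a + b(d+3) presents Z_n as the quotient of Z² by the
lattice spanned by (d+3, -1) and (-1, d+2). In these coordinates σ_i is a horizontal segment of d+2
points, μ_i a vertical one, and the α_{k,i} are hooks with corner i that trade horizontal points for
vertical ones, one at a time. The two families differ only in the order in which the vertical points
enter. The box |a|, |b| ≤ 2d+2 contains very few relations (`small_relations`), so incidence
questions become linear arithmetic on coordinates.

Translations are automorphisms, and every automorphism of a complex preserves its boundary
(`aut_le_aut_boundary`). It remains to see that each automorphism f of the boundary is a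
translation.

Let d ≥ 3. A boundary ridge of a hook contains the edge joining the two tips of the hook; that edge
lies in no other facet, and any two vertices of its link are joined in the link. Boundary ridges of
segments contain no such edge (`stiffFacet_boundary_iff`). So f permutes the punctured segments. The
number of vertices sharing a punctured segment with a given pair detects unit steps
(`ncard_jointLink_le`, `le_ncard_jointLink`), so f carries the horizontal line, which runs through
all vertices, to a line traversed in unit steps: f x = f 0 ± x or f 0 ± (d+3)x (`map_affine`). In
`map_eq_add` the factor ±(d+3) fails because (d+3)² = 1 + (d+3) moves vertical unit steps off both
axes, and -1 fails because the admissible punctures 2, …, d of the segment 0, …, d+1 are not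
symmetric under reversal.

For d = 2 a hook has only two free points and this argument breaks down. The boundary is then a
surface on 19 vertices in which the link of 0 is an 18-cycle. An automorphism fixing 0 acts on this
cycle as a dihedral symmetry, and a finite check at the vertex 1 leaves only the identity
(`surface_rigid`). -/

namespace CyclicManifold

/-! ### Lattice coordinates on Z_n -/

section Lattice

variable {d : ℕ}

/-- The vertex `a_{i - (a + b (d+3))}`. -/
def pt (i : Vertex d) (a b : ℤ) : Vertex d := i - ((a : Vertex d) + b * ((d : Vertex d) + 3))

theorem intCast_eq_zero_iff (z : ℤ) :
    (z : Vertex d) = 0 ↔ ∃ t : ℤ, z = t * ((d + 3) * (d + 2) - 1) := by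
  rw [ZMod.intCast_zmod_eq_zero_iff_dvd, dvd_def]
  have h : ((vertexCount d : ℕ) : ℤ) = (d + 3) * (d + 2) - 1 := by
    simp only [vertexCount]; push_cast; ring
  rw [h]
  simp only [mul_comm]

theorem mul_inv_step : ((d : Vertex d) + 3) * ((d : Vertex d) + 2) = 1 := by
  have := (intCast_eq_zero_iff (d := d) ((d + 3) * (d + 2) - 1)).2 ⟨1, by ring⟩
  push_cast at this
  linear_combination this

/-- Small integer relations `a + b (d+3) = 0` modulo `n`. -/
theorem small_relations {a b : ℤ} (h : (a : Vertex d) + b * ((d : Vertex d) + 3) = 0)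
    (ha : |a| ≤ 2 * d + 2) (hb : |b| ≤ 2 * d + 2) :
    (a = 0 ∧ b = 0) ∨ (a = d + 3 ∧ b = -1) ∨ (a = -(d + 3) ∧ b = 1) ∨
    (a = 1 ∧ b = -(d + 2)) ∨ (a = -1 ∧ b = d + 2) ∨
    (a = d + 2 ∧ b = d + 1) ∨ (a = -(d + 2) ∧ b = -(d + 1)) ∨
    (a = d + 4 ∧ b = -(d + 3)) ∨ (a = -(d + 4) ∧ b = d + 3) := by
  have h' : ((a + b * (d + 3) : ℤ) : Vertex d) = 0 := by push_cast; exact h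
  obtain ⟨t, ht⟩ := (intCast_eq_zero_iff _).1 h'
  -- Here (a, b) = w (d+3, -1) + t (-1, d+2). The bounds on a and b force |w|, |t| ≤ 1, because
  -- (2d+2)(d+4) < 2n; the nine pairs (w, t) are the nine cases.
  obtain ⟨w, hw⟩ : ∃ w : ℤ, w = t * (d + 2) - b := ⟨_, rfl⟩
  have hb' : b = t * (d + 2) - w := by rw [hw]; ring
  have ha' : a = w * (d + 3) - t := by rw [hw]; linear_combination ht
  rw [abs_le] at ha hb
  have hd : (0 : ℤ) ≤ d := Int.natCast_nonneg d
  have e1 : w * ((d + 3) * (d + 2) - 1) = (d + 2) * a + b := by rw [ha', hb']; ring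
  have w1 : w < 2 := by
    by_contra hc
    nlinarith [mul_le_mul_of_nonneg_left ha.2 (by omega : (0 : ℤ) ≤ d + 2),
      mul_le_mul_of_nonneg_right (by omega : 2 ≤ w)
        (by nlinarith : (0 : ℤ) ≤ (d + 3) * (d + 2) - 1)]
  have w2 : -2 < w := by
    by_contra hc
    nlinarith [mul_le_mul_of_nonneg_left ha.1 (by omega : (0 : ℤ) ≤ d + 2),
      mul_le_mul_of_nonneg_right (by omega : w ≤ -2)
        (by nlinarith : (0 : ℤ) ≤ (d + 3) * (d + 2) - 1)]
  have t1 : t < 2 := by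
    by_contra hc
    nlinarith [mul_le_mul_of_nonneg_left hb.2 (by omega : (0 : ℤ) ≤ d + 3),
      mul_le_mul_of_nonneg_right (by omega : 2 ≤ t)
        (by nlinarith : (0 : ℤ) ≤ (d + 3) * (d + 2) - 1)]
  have t2 : -2 < t := by
    by_contra hc
    nlinarith [mul_le_mul_of_nonneg_left hb.1 (by omega : (0 : ℤ) ≤ d + 3),
      mul_le_mul_of_nonneg_right (by omega : t ≤ -2)
        (by nlinarith : (0 : ℤ) ≤ (d + 3) * (d + 2) - 1)]
  clear ht h h' hw e1
  interval_cases w <;> interval_cases t <;> omega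

theorem pt_eq_pt_iff {i : Vertex d} {a b a' b' : ℤ} :
    pt i a b = pt i a' b' ↔ ((a - a' : ℤ) : Vertex d) + (b - b' : ℤ) * ((d : Vertex d) + 3) = 0 := by
  unfold pt
  push_cast
  constructor
  · intro h; linear_combination -h
  · intro h; linear_combination -h

theorem pt_pt (i : Vertex d) (a b a' b' : ℤ) : pt (pt i a b) a' b' = pt i (a + a') (b + b') := by
  unfold pt; push_cast; ring

@[simp] theorem pt_zero (i : Vertex d) : pt i 0 0 = i := by simp [pt]

/-- Each nonzero relation in `small_relations` has a coordinate of absolute value above d + 1, so a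
box of side d + 1 embeds in Z_n. -/
theorem pt_injOn_small {i : Vertex d} {a b a' b' : ℤ} (h : pt i a b = pt i a' b')
    (ha : |a - a'| ≤ d + 1) (hb : |b - b'| ≤ d + 1) : a = a' ∧ b = b' := by
  rw [pt_eq_pt_iff] at h
  rw [abs_le] at *
  have := small_relations h (abs_le.2 ⟨by omega, by omega⟩) (abs_le.2 ⟨by omega, by omega⟩)
  omega

end Lattice

/-! ### Facets as segments and hooks -/

section Facets

/-- The points `(a, b)` of the base facet of index `k`: `σ` for `k = 0`, `μ` for `k = d + 1`
and `α_k` in between; `m` selects the family. -/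
def InShape (m : Bool) (d : ℕ) (k a b : ℤ) : Prop :=
  (k = 0 ∧ b = 0 ∧ 0 ≤ a ∧ a ≤ d + 1) ∨ (k = d + 1 ∧ a = 0 ∧ 0 ≤ b ∧ b ≤ d + 1) ∨
  (1 ≤ k ∧ k ≤ d ∧ ((a = 0 ∧ b = 0) ∨ (b = 0 ∧ 2 ≤ a ∧ a ≤ d + 2 - k) ∨
    (a = 0 ∧ if m then d + 2 - k ≤ b ∧ b ≤ d + 1 else 2 ≤ b ∧ b ≤ k + 1)))

variable {m : Bool} {d : ℕ}

theorem InShape.bounds {k a b : ℤ} (h : InShape m d k a b) :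
    0 ≤ a ∧ a ≤ d + 1 ∧ 0 ≤ b ∧ b ≤ d + 1 ∧ (a = 0 ∨ b = 0) := by
  unfold InShape at h
  cases m <;> simp only [if_true, if_false, Bool.false_eq_true] at h <;> omega

open Classical in
/-- The facets of both complexes. -/
noncomputable def fac (m : Bool) (k : ℤ) (i : Vertex d) : Finset (Vertex d) :=
  ((Finset.Icc (0 : ℤ) (d + 1) ×ˢ Finset.Icc (0 : ℤ) (d + 1)).filter
    fun p => InShape m d k p.1 p.2).image fun p => pt i p.1 p.2

theorem mem_fac {k : ℤ} {i x : Vertex d} :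
    x ∈ fac m k i ↔ ∃ a b, InShape m d k a b ∧ x = pt i a b := by
  classical
  simp only [fac, Finset.mem_image, Finset.mem_filter, Finset.mem_product, Finset.mem_Icc,
    Prod.exists]
  constructor
  · rintro ⟨a, b, ⟨_, h⟩, rfl⟩; exact ⟨a, b, h, rfl⟩
  · rintro ⟨a, b, h, rfl⟩
    have := h.bounds
    exact ⟨a, b, ⟨by omega, h⟩, rfl⟩

theorem pt_mem_fac {k a b : ℤ} {i : Vertex d} (h : InShape m d k a b) : pt i a b ∈ fac m k i :=
  mem_fac.2 ⟨a, b, h, rfl⟩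

theorem pt_mem_fac_iff {k a b : ℤ} {i : Vertex d} (ha : 0 ≤ a ∧ a ≤ d + 1)
    (hb : 0 ≤ b ∧ b ≤ d + 1) : pt i a b ∈ fac m k i ↔ InShape m d k a b := by
  refine ⟨fun h => ?_, pt_mem_fac⟩
  obtain ⟨a', b', h', e⟩ := mem_fac.1 h
  have := h'.bounds
  obtain ⟨rfl, rfl⟩ := pt_injOn_small e (abs_le.2 ⟨by omega, by omega⟩)
    (abs_le.2 ⟨by omega, by omega⟩)
  exact h'

/-- The family of facets of `𝓜` (`m = true`) or `𝓝` (`m = false`). -/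
def Facs (m : Bool) (d : ℕ) : Set (Finset (Vertex d)) :=
  {s | ∃ (k : ℤ) (i : Vertex d), 0 ≤ k ∧ k ≤ d + 1 ∧ s = fac m k i}

theorem fac_mem_Facs {k : ℤ} {i : Vertex d} (h0 : 0 ≤ k) (h1 : k ≤ d + 1) :
    fac m k i ∈ Facs m d := ⟨k, i, h0, h1, rfl⟩

/-- Two points of a facet whose difference is a given small vector. -/
theorem exists_base_of_mem {k : ℤ} {i j : Vertex d} {a b a' b' : ℤ}
    (h : pt i a b ∈ fac m k j) (h' : pt i a' b' ∈ fac m k j)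
    (ha : |a' - a| ≤ d + 1) (hb : |b' - b| ≤ d + 1) :
    ∃ x y x' y', InShape m d k x y ∧ InShape m d k x' y' ∧
      pt i a b = pt j x y ∧ pt i a' b' = pt j x' y' ∧
      (let u := (a' - a) - (x' - x); let v := (b' - b) - (y' - y);
      (u = 0 ∧ v = 0) ∨ (u = d + 3 ∧ v = -1) ∨ (u = -(d + 3) ∧ v = 1) ∨
      (u = 1 ∧ v = -(d + 2)) ∨ (u = -1 ∧ v = d + 2) ∨
      (u = d + 2 ∧ v = d + 1) ∨ (u = -(d + 2) ∧ v = -(d + 1)) ∨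
      (u = d + 4 ∧ v = -(d + 3)) ∨ (u = -(d + 4) ∧ v = d + 3)) := by
  obtain ⟨x, y, s, e⟩ := mem_fac.1 h
  obtain ⟨x', y', s', e'⟩ := mem_fac.1 h'
  refine ⟨x, y, x', y', s, s', e, e', ?_⟩
  have b1 := s.bounds
  have b2 := s'.bounds
  rw [abs_le] at ha hb
  refine small_relations ?_ (abs_le.2 ⟨by omega, by omega⟩) (abs_le.2 ⟨by omega, by omega⟩)
  unfold pt at e e'
  push_cast
  linear_combination e - e'

theorem eq_of_pt_eq {i j : Vertex d} {a b : ℤ} (h : pt i a b = pt j a b) : i = j := by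
  unfold pt at h; simpa using h

/-- The hook α_1 keeps both ends of the horizontal segment, so the ends alone cannot exclude k = 1;
`index_of_row` does so with the point (1, 0). -/
theorem facet_of_row_ends (hd : 2 ≤ d) {k : ℤ} {i j : Vertex d}
    (h0 : pt i 0 0 ∈ fac m k j) (h1 : pt i (d + 1) 0 ∈ fac m k j) : j = i ∧ (k = 0 ∨ k = 1) := by
  obtain ⟨x, y, x', y', s, s', e, e', r⟩ := exists_base_of_mem h0 h1
    (abs_le.2 ⟨by omega, by omega⟩) (abs_le.2 ⟨by omega, by omega⟩)
  have : x = 0 ∧ y = 0 ∧ (k = 0 ∨ k = 1) := by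
    unfold InShape at s s'
    cases m <;> simp only [if_true, if_false, Bool.false_eq_true] at s s' <;> dsimp only at r <;> omega
  obtain ⟨rfl, rfl, hk⟩ := this
  exact ⟨(eq_of_pt_eq e).symm, hk⟩

theorem facet_of_col_ends (hd : 2 ≤ d) {k : ℤ} {i j : Vertex d}
    (h0 : pt i 0 0 ∈ fac m k j) (h1 : pt i 0 (d + 1) ∈ fac m k j) :
    j = i ∧ 1 ≤ k := by
  obtain ⟨x, y, x', y', s, s', e, e', r⟩ := exists_base_of_mem h0 h1
    (abs_le.2 ⟨by omega, by omega⟩) (abs_le.2 ⟨by omega, by omega⟩)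
  have : x = 0 ∧ y = 0 ∧ 1 ≤ k := by
    unfold InShape at s s'
    cases m <;> simp only [if_true, if_false, Bool.false_eq_true] at s s' <;> dsimp only at r <;> omega
  obtain ⟨rfl, rfl, hk⟩ := this
  exact ⟨(eq_of_pt_eq e).symm, hk⟩

/-- The second coordinate of the end of the edge of `α_k` that lies in no other facet; the other
end is `(d + 2 - k, 0)`. -/
def tip (m : Bool) (d : ℕ) (k : ℤ) : ℤ := if m then d + 2 - k else k + 1

/-- Among hooks with the same corner, the horizontal tip forces l ≤ k and the vertical tip forces l
≥ k; the small relations exclude other corners. -/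
theorem facet_of_tips (hd : 2 ≤ d) {k l : ℤ} {i j : Vertex d} (hk : 1 ≤ k ∧ k ≤ d)
    (h0 : pt i (d + 2 - k) 0 ∈ fac m l j) (h1 : pt i 0 (tip m d k) ∈ fac m l j) :
    j = i ∧ l = k := by
  obtain ⟨x, y, x', y', s, s', e, e', r⟩ := exists_base_of_mem h0 h1
    (abs_le.2 ⟨by omega, by omega⟩) (by unfold tip; split_ifs <;> exact abs_le.2 ⟨by omega, by omega⟩)
  have : x = d + 2 - k ∧ y = 0 ∧ l = k := by
    unfold InShape at s s'
    unfold tip at r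
    cases m <;> simp only [if_true, if_false, Bool.false_eq_true] at s s' r <;> omega
  obtain ⟨rfl, rfl, hk⟩ := this
  exact ⟨(eq_of_pt_eq e).symm, hk⟩

end Facets

/-! ### The given facet lists in coordinates -/

section Identification

variable {d : ℕ}

theorem sigma_eq_fac (m : Bool) (i : Vertex d) : sigma d i = fac m 0 i := by
  ext x
  simp only [sigma, Finset.mem_image, Finset.mem_Icc, mem_fac]
  constructor
  · rintro ⟨j, ⟨_, hj⟩, rfl⟩
    exact ⟨j, 0, Or.inl ⟨rfl, rfl, by omega, by omega⟩, by simp [pt]⟩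
  · rintro ⟨a, b, h, rfl⟩
    have hb := h.bounds
    unfold InShape at h
    lift a to ℕ using hb.1
    obtain rfl : b = 0 := by omega
    exact ⟨a, by omega, by simp [pt]⟩

theorem muN_eq_fac (m : Bool) (i : Vertex d) : muN d i = fac m (d + 1) i := by
  ext x
  simp only [muN, Finset.mem_image, Finset.mem_Icc, mem_fac]
  constructor
  · rintro ⟨j, ⟨_, hj⟩, rfl⟩
    exact ⟨0, j, Or.inr (Or.inl ⟨rfl, rfl, by omega, by omega⟩), by simp [pt]⟩
  · rintro ⟨a, b, h, rfl⟩
    have hb := h.bounds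
    unfold InShape at h
    lift b to ℕ using hb.2.2.1
    obtain rfl : a = 0 := by omega
    exact ⟨b, by omega, by simp [pt]⟩

/-- As (d+2)(d+3) = 1, subtracting 1 amounts to d + 2 vertical steps. This reverses the vertical arm
in the first family. -/
theorem sub_one_add_eq (i : Vertex d) (j : ℕ) :
    i + (j : Vertex d) * ((d : Vertex d) + 3) - 1 = pt i 0 (d + 2 - j : ℤ) := by
  unfold pt; push_cast
  linear_combination mul_inv_step (d := d)

theorem muM_eq_fac (m : Bool) (i : Vertex d) : muM d i = fac m (d + 1) i := by
  ext x
  simp only [muM, Finset.mem_union, Finset.mem_singleton, Finset.mem_image, Finset.mem_Icc,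
    mem_fac, sub_one_add_eq]
  constructor
  · rintro (rfl | ⟨j, ⟨_, hj⟩, rfl⟩)
    · exact ⟨0, 0, Or.inr (Or.inl ⟨rfl, rfl, by omega, by omega⟩), by simp⟩
    · exact ⟨0, d + 2 - j, Or.inr (Or.inl ⟨rfl, rfl, by omega, by omega⟩), rfl⟩
  · rintro ⟨a, b, h, rfl⟩
    have hb := h.bounds
    unfold InShape at h
    obtain rfl : a = 0 := by omega
    lift b to ℕ using hb.2.2.1
    rcases Nat.eq_zero_or_pos b with rfl | hpos
    · left; simp
    · right
      exact ⟨d + 2 - b, by omega, by congr 1; omega⟩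

theorem alphaM_eq_fac {k : ℕ} (h1 : 1 ≤ k) (h2 : k ≤ d) (i : Vertex d) :
    alphaM d k i = fac true k i := by
  ext x
  simp only [alphaM, Finset.mem_union, Finset.mem_singleton, Finset.mem_image, Finset.mem_Icc,
    mem_fac, sub_one_add_eq]
  constructor
  · rintro ((rfl | ⟨j, hj, rfl⟩) | ⟨j, hj, rfl⟩)
    · exact ⟨0, 0, Or.inr (Or.inr ⟨by omega, by omega, by simp⟩), by simp⟩
    · exact ⟨j, 0, Or.inr (Or.inr ⟨by omega, by omega, Or.inr (Or.inl (by omega))⟩), by simp [pt]⟩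
    · exact ⟨0, d + 2 - j, Or.inr (Or.inr ⟨by omega, by omega, Or.inr (Or.inr
        ⟨rfl, by simp only [if_true]; omega⟩)⟩), rfl⟩
  · rintro ⟨a, b, h, rfl⟩
    have hb := h.bounds
    unfold InShape at h
    simp only [if_true] at h
    lift a to ℕ using hb.1
    lift b to ℕ using hb.2.2.1
    rcases (by omega : (a = 0 ∧ b = 0) ∨ (b = 0 ∧ 2 ≤ a ∧ a ≤ d + 2 - k) ∨
      (a = 0 ∧ 1 ≤ d + 2 - b ∧ d + 2 - b ≤ k)) with ⟨rfl, rfl⟩ | ⟨rfl, h'⟩ | ⟨rfl, h'⟩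
    · simp
    · exact Or.inl (Or.inr ⟨a, h', by simp [pt]⟩)
    · exact Or.inr ⟨d + 2 - b, h', by congr 1; omega⟩

theorem alphaN_eq_fac {k : ℕ} (h1 : 1 ≤ k) (h2 : k ≤ d) (i : Vertex d) :
    alphaN d k i = fac false k i := by
  ext x
  simp only [alphaN, Finset.mem_union, Finset.mem_singleton, Finset.mem_image, Finset.mem_Icc,
    mem_fac]
  constructor
  · rintro ((rfl | ⟨j, hj, rfl⟩) | ⟨j, hj, rfl⟩)
    · exact ⟨0, 0, Or.inr (Or.inr ⟨by omega, by omega, by simp⟩), by simp⟩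
    · exact ⟨j, 0, Or.inr (Or.inr ⟨by omega, by omega, Or.inr (Or.inl (by omega))⟩), by simp [pt]⟩
    · exact ⟨0, j, Or.inr (Or.inr ⟨by omega, by omega, Or.inr (Or.inr
        ⟨rfl, by simp only [if_false, Bool.false_eq_true]; omega⟩)⟩), by simp [pt]⟩
  · rintro ⟨a, b, h, rfl⟩
    have hb := h.bounds
    unfold InShape at h
    simp only [if_false, Bool.false_eq_true] at h
    lift a to ℕ using hb.1
    lift b to ℕ using hb.2.2.1
    rcases (by omega : (a = 0 ∧ b = 0) ∨ (b = 0 ∧ 2 ≤ a ∧ a ≤ d + 2 - k) ∨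
      (a = 0 ∧ 2 ≤ b ∧ b ≤ k + 1)) with ⟨rfl, rfl⟩ | ⟨rfl, h'⟩ | ⟨rfl, h'⟩
    · simp
    · exact Or.inl (Or.inr ⟨a, h', by simp [pt]⟩)
    · exact Or.inr ⟨b, h', by simp [pt]⟩

theorem facetsM_eq : facetsM d = Facs true d := by
  ext s
  simp only [facetsM, Facs, Set.mem_ofPred_eq]
  constructor
  · rintro (⟨i, rfl⟩ | ⟨i, rfl⟩ | ⟨k, i, h1, h2, rfl⟩)
    · exact ⟨0, i, by omega, by omega, sigma_eq_fac _ i⟩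
    · exact ⟨d + 1, i, by omega, by omega, muM_eq_fac _ i⟩
    · exact ⟨k, i, by omega, by omega, alphaM_eq_fac h1 h2 i⟩
  · rintro ⟨k, i, h1, h2, rfl⟩
    lift k to ℕ using h1
    rcases (by omega : k = 0 ∨ k = d + 1 ∨ (1 ≤ k ∧ k ≤ d)) with rfl | rfl | ⟨h1, h2⟩
    · exact Or.inl ⟨i, (sigma_eq_fac _ i).symm⟩
    · exact Or.inr (Or.inl ⟨i, (muM_eq_fac _ i).symm⟩)
    · exact Or.inr (Or.inr ⟨k, i, h1, h2, (alphaM_eq_fac h1 h2 i).symm⟩)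

theorem facetsN_eq : facetsN d = Facs false d := by
  ext s
  simp only [facetsN, Facs, Set.mem_ofPred_eq]
  constructor
  · rintro (⟨i, rfl⟩ | ⟨i, rfl⟩ | ⟨k, i, h1, h2, rfl⟩)
    · exact ⟨0, i, by omega, by omega, sigma_eq_fac _ i⟩
    · exact ⟨d + 1, i, by omega, by omega, muN_eq_fac _ i⟩
    · exact ⟨k, i, by omega, by omega, alphaN_eq_fac h1 h2 i⟩
  · rintro ⟨k, i, h1, h2, rfl⟩
    lift k to ℕ using h1
    rcases (by omega : k = 0 ∨ k = d + 1 ∨ (1 ≤ k ∧ k ≤ d)) with rfl | rfl | ⟨h1, h2⟩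
    · exact Or.inl ⟨i, (sigma_eq_fac _ i).symm⟩
    · exact Or.inr (Or.inl ⟨i, (muN_eq_fac _ i).symm⟩)
    · exact Or.inr (Or.inr ⟨k, i, h1, h2, (alphaN_eq_fac h1 h2 i).symm⟩)

end Identification

/-! ### Maximal faces, adjacency of facets and boundary ridges -/

section Boundary

variable {m : Bool} {d : ℕ}

/-- Either complex, according to `m`. -/
def cal (m : Bool) (d : ℕ) : PreAbstractSimplicialComplex (Vertex d) := generated (Facs m d)

theorem inShape_row {a : ℤ} (h0 : 0 ≤ a) (h1 : a ≤ d + 1) : InShape m d 0 a 0 :=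
  Or.inl ⟨rfl, rfl, h0, h1⟩

theorem inShape_col {b : ℤ} (h0 : 0 ≤ b) (h1 : b ≤ d + 1) : InShape m d (d + 1) 0 b :=
  Or.inr (Or.inl ⟨rfl, rfl, h0, h1⟩)

theorem inShape_tip {k : ℤ} (hk : 1 ≤ k ∧ k ≤ d) : InShape m d k 0 (tip m d k) := by
  refine Or.inr (Or.inr ⟨hk.1, hk.2, Or.inr (Or.inr ⟨rfl, ?_⟩)⟩)
  unfold tip
  split_ifs <;> omega

theorem inShape_tip' {k : ℤ} (hk : 1 ≤ k ∧ k ≤ d) : InShape m d k (d + 2 - k) 0 :=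
  Or.inr (Or.inr ⟨hk.1, hk.2, Or.inr (Or.inl ⟨rfl, by omega, le_rfl⟩)⟩)

theorem index_of_row {k : ℤ} {i j : Vertex d} (hd : 2 ≤ d) (h0 : pt i 0 0 ∈ fac m k j)
    (h1 : pt i 1 0 ∈ fac m k j) (h2 : pt i (d + 1) 0 ∈ fac m k j) : j = i ∧ k = 0 := by
  obtain ⟨rfl, hk⟩ := facet_of_row_ends hd h0 h2
  rw [pt_mem_fac_iff (by omega) (by omega)] at h1
  refine ⟨rfl, ?_⟩
  unfold InShape at h1
  omega

theorem index_of_col {k : ℤ} {i j : Vertex d} (hd : 2 ≤ d) (h0 : pt i 0 0 ∈ fac m k j)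
    (h1 : pt i 0 1 ∈ fac m k j) (h2 : pt i 0 (d + 1) ∈ fac m k j) : j = i ∧ k = d + 1 := by
  obtain ⟨rfl, hk⟩ := facet_of_col_ends hd h0 h2
  rw [pt_mem_fac_iff (by omega) (by omega)] at h1
  refine ⟨rfl, ?_⟩
  unfold InShape at h1
  cases m <;> simp only [if_true, if_false, Bool.false_eq_true] at h1 <;> omega

/-- The points of the base facet which are opposite to a boundary ridge. -/
def Free (m : Bool) (d : ℕ) (k a b : ℤ) : Prop :=
  InShape m d k a b ∧ (k = 0 → 2 ≤ a ∧ a ≤ d) ∧ (k = d + 1 → 2 ≤ b ∧ b ≤ d) ∧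
    (1 ≤ k ∧ k ≤ d → ¬ (a = d + 2 - k ∧ b = 0) ∧ ¬ (a = 0 ∧ b = tip m d k))

/-- The points that identify a facet (first, second and last of a segment, the two tips of a hook)
are exactly the non-free ones, so they survive the deletion of a free point. -/
theorem index_of_erase_subset (hd : 2 ≤ d) {k l a b : ℤ} {i j : Vertex d} (h0 : 0 ≤ k)
    (h1 : k ≤ d + 1) (hf : Free m d k a b) (h : (fac m k i).erase (pt i a b) ⊆ fac m l j) :
    j = i ∧ l = k := by
  have hb := hf.1.bounds
  have key : ∀ x y, InShape m d k x y → ¬ (x = a ∧ y = b) → pt i x y ∈ fac m l j := by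
    intro x y hs hne
    refine h (Finset.mem_erase.2 ⟨fun e => hne ?_, pt_mem_fac hs⟩)
    have := hs.bounds
    exact pt_injOn_small e (abs_le.2 ⟨by omega, by omega⟩) (abs_le.2 ⟨by omega, by omega⟩)
  obtain ⟨_, f0, f1, f2⟩ := hf
  rcases (by omega : k = 0 ∨ k = d + 1 ∨ (1 ≤ k ∧ k ≤ d)) with rfl | rfl | hk
  · have := f0 rfl
    exact index_of_row hd (key _ _ (inShape_row (by omega) (by omega)) (by omega))
      (key _ _ (inShape_row (by omega) (by omega)) (by omega))
      (key _ _ (inShape_row (by omega) (by omega)) (by omega))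
  · have := f1 rfl
    exact index_of_col hd (key _ _ (inShape_col (by omega) (by omega)) (by omega))
      (key _ _ (inShape_col (by omega) (by omega)) (by omega))
      (key _ _ (inShape_col (by omega) (by omega)) (by omega))
  · have := f2 hk
    exact facet_of_tips hd hk (key _ _ (inShape_tip' hk) fun e => this.1 ⟨e.1.symm, e.2.symm⟩)
      (key _ _ (inShape_tip hk) fun e => this.2 ⟨e.1.symm, e.2.symm⟩)

theorem exists_free (hd : 2 ≤ d) {k : ℤ} (h0 : 0 ≤ k) (h1 : k ≤ d + 1) :
    ∃ a b, Free m d k a b := by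
  rcases (by omega : k = 0 ∨ k = d + 1 ∨ (1 ≤ k ∧ k ≤ d)) with rfl | rfl | hk
  · exact ⟨2, 0, inShape_row (by omega) (by omega), by omega, by omega, by omega⟩
  · exact ⟨0, 2, inShape_col (by omega) (by omega), by omega, by omega, by omega⟩
  · refine ⟨0, 0, Or.inr (Or.inr ⟨hk.1, hk.2, Or.inl ⟨rfl, rfl⟩⟩), by omega, by omega, ?_⟩
    unfold tip; split_ifs <;> omega

theorem index_of_subset (hd : 2 ≤ d) {k l : ℤ} {i j : Vertex d} (h0 : 0 ≤ k)
    (h1 : k ≤ d + 1) (h : fac m k i ⊆ fac m l j) : j = i ∧ l = k := by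
  obtain ⟨a, b, hf⟩ := exists_free (m := m) hd h0 h1
  exact index_of_erase_subset hd h0 h1 hf ((Finset.erase_subset _ _).trans h)

theorem self_mem_fac {k : ℤ} (h0 : 0 ≤ k) (h1 : k ≤ d + 1) (i : Vertex d) : i ∈ fac m k i := by
  rw [mem_fac]
  refine ⟨0, 0, ?_, by simp⟩
  unfold InShape
  omega

theorem isFacet_cal_iff (hd : 2 ≤ d) {s : Finset (Vertex d)} :
    IsFacet (cal m d) s ↔ s ∈ Facs m d := by
  constructor
  · rintro ⟨⟨hs, t, ht, hst⟩, hmax⟩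
    rw [← hmax t ⟨hs.mono hst, t, ht, Finset.Subset.refl _⟩ hst]
    exact ht
  · rintro ⟨k, i, h0, h1, rfl⟩
    refine ⟨⟨⟨i, self_mem_fac h0 h1 i⟩, _, fac_mem_Facs h0 h1, Finset.Subset.refl _⟩, ?_⟩
    rintro t ⟨_, u, ⟨l, j, _, _, rfl⟩, htu⟩ hst
    obtain ⟨rfl, rfl⟩ := index_of_subset hd h0 h1 (hst.trans htu)
    exact htu.antisymm hst

theorem erase_subset_fac {k l a b : ℤ} {i : Vertex d} (u v : ℤ)
    (h : ∀ x y, InShape m d k x y → ¬ (x = a ∧ y = b) → InShape m d l (x - u) (y - v)) :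
    (fac m k i).erase (pt i a b) ⊆ fac m l (pt i u v) := by
  intro z hz
  obtain ⟨hne, hz⟩ := Finset.mem_erase.1 hz
  obtain ⟨x, y, hs, rfl⟩ := mem_fac.1 hz
  refine mem_fac.2 ⟨x - u, y - v, h x y hs ?_, ?_⟩
  · rintro ⟨rfl, rfl⟩; exact hne rfl
  · rw [pt_pt]; congr 1 <;> ring

theorem InShape.succ {k a b : ℤ} (h : InShape m d k a b) (hk : 1 ≤ k ∧ k ≤ d)
    (hne : ¬ (a = d + 2 - k ∧ b = 0)) : InShape m d (k + 1) a b := by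
  rcases hk.2.lt_or_eq with h2 | rfl
  · refine Or.inr (Or.inr ⟨by omega, by omega, ?_⟩)
    unfold InShape at h
    cases m <;> simp only [if_true, if_false, Bool.false_eq_true] at h ⊢ <;> omega
  · refine Or.inr (Or.inl ⟨rfl, ?_⟩)
    unfold InShape at h
    cases m <;> simp only [if_true, if_false, Bool.false_eq_true] at h ⊢ <;> omega

theorem InShape.pred {k a b : ℤ} (h : InShape m d k a b) (hk : 1 ≤ k ∧ k ≤ d)
    (hne : ¬ (a = 0 ∧ b = tip m d k)) : InShape m d (k - 1) a b := by
  unfold tip at hne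
  rcases hk.1.lt_or_eq with h2 | rfl
  · refine Or.inr (Or.inr ⟨by omega, by omega, ?_⟩)
    unfold InShape at h
    cases m <;> simp only [if_true, if_false, Bool.false_eq_true] at h hne ⊢ <;> omega
  · refine Or.inl ⟨rfl, ?_⟩
    unfold InShape at h
    cases m <;> simp only [if_true, if_false, Bool.false_eq_true] at h hne ⊢ <;> omega

/-- Deleting an end of a segment leaves a ridge shared with its translate by one step. All other
interior ridges come from the chain σ_i, α_{1,i}, …, α_{d,i}, μ_i, whose consecutive members differ
by the exchange of one point. -/
theorem exists_neighbour (hd : 2 ≤ d) {k a b : ℤ} (i : Vertex d) (h0 : 0 ≤ k) (h1 : k ≤ d + 1)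
    (hs : InShape m d k a b) (hf : ¬ Free m d k a b) :
    ∃ (l : ℤ) (j : Vertex d), 0 ≤ l ∧ l ≤ d + 1 ∧ (fac m k i).erase (pt i a b) ⊆ fac m l j ∧ ¬ (j = i ∧ l = k) := by
  have shift : ∀ u v : ℤ, |u| ≤ d + 1 → |v| ≤ d + 1 → ¬ (u = 0 ∧ v = 0) → pt i u v ≠ i := by
    intro u v hu hv hne e
    refine hne (pt_injOn_small (i := i) (b' := 0) ?_ (by simpa using hu) (by simpa using hv))
    simpa using e
  have hb := hs.bounds
  rcases (by omega : k = 0 ∨ k = d + 1 ∨ (1 ≤ k ∧ k ≤ d)) with rfl | rfl | hk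
  · have hb0 : b = 0 := by unfold InShape at hs; omega
    have : a = 0 ∨ a = 1 ∨ a = d + 1 := by
      by_contra hc
      exact hf ⟨hs, by omega, by omega, by omega⟩
    rcases this with rfl | rfl | rfl
    · refine ⟨0, pt i 1 0, by omega, by omega, erase_subset_fac _ _ ?_,
        fun e => shift 1 0 (abs_le.2 ⟨by omega, by omega⟩) (abs_le.2 ⟨by omega, by omega⟩)
          (by omega) e.1⟩
      unfold InShape; omega
    · refine ⟨1, pt i 0 0, by omega, by omega, erase_subset_fac _ _ ?_, by omega⟩
      unfold InShape; omega
    · refine ⟨0, pt i (-1) 0, by omega, by omega, erase_subset_fac _ _ ?_,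
        fun e => shift (-1) 0 (abs_le.2 ⟨by omega, by omega⟩) (abs_le.2 ⟨by omega, by omega⟩)
          (by omega) e.1⟩
      unfold InShape; omega
  · have hb0 : a = 0 := by unfold InShape at hs; omega
    have : b = 0 ∨ b = 1 ∨ b = d + 1 := by
      by_contra hc
      exact hf ⟨hs, by omega, by omega, by omega⟩
    rcases this with rfl | rfl | rfl
    · refine ⟨d + 1, pt i 0 1, by omega, by omega, erase_subset_fac _ _ ?_,
        fun e => shift 0 1 (abs_le.2 ⟨by omega, by omega⟩) (abs_le.2 ⟨by omega, by omega⟩)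
          (by omega) e.1⟩
      unfold InShape; omega
    · refine ⟨d, pt i 0 0, by omega, by omega, erase_subset_fac _ _ ?_, by omega⟩
      unfold InShape
      cases m <;> simp only [if_true, if_false, Bool.false_eq_true] <;> omega
    · refine ⟨d + 1, pt i 0 (-1), by omega, by omega, erase_subset_fac _ _ ?_,
        fun e => shift 0 (-1) (abs_le.2 ⟨by omega, by omega⟩) (abs_le.2 ⟨by omega, by omega⟩)
          (by omega) e.1⟩
      unfold InShape; omega
  · have : (a = d + 2 - k ∧ b = 0) ∨ (a = 0 ∧ b = tip m d k) := by
      by_contra hc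
      rw [not_or] at hc
      exact hf ⟨hs, by omega, by omega, fun _ => hc⟩
    rcases this with ⟨rfl, rfl⟩ | ⟨rfl, rfl⟩
    · refine ⟨k + 1, pt i 0 0, by omega, by omega, erase_subset_fac _ _ fun x y h hne => ?_,
        by omega⟩
      simpa using h.succ hk hne
    · refine ⟨k - 1, pt i 0 0, by omega, by omega, erase_subset_fac _ _ fun x y h hne => ?_,
        by omega⟩
      simpa using h.pred hk hne

theorem mem_boundaryFacets_iff (hd : 2 ≤ d) {t : Finset (Vertex d)} :
    t ∈ boundaryFacets (cal m d) ↔ ∃ (k : ℤ) (i : Vertex d) (a b : ℤ), 0 ≤ k ∧ k ≤ d + 1 ∧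
      Free m d k a b ∧ t = (fac m k i).erase (pt i a b) := by
  constructor
  · rintro ⟨_, s, hs, hts, hcard, huniq⟩
    obtain ⟨k, i, h0, h1, rfl⟩ := (isFacet_cal_iff hd).1 hs
    obtain ⟨v, hv, hvt⟩ : ∃ v ∈ fac m k i, v ∉ t := by
      by_contra! hc
      have := Finset.card_le_card (show fac m k i ⊆ t from hc)
      omega
    obtain rfl : t = (fac m k i).erase v := by
      refine Finset.eq_of_subset_of_card_le (fun x hx => Finset.mem_erase.2
        ⟨fun e => hvt (e ▸ hx), hts hx⟩) ?_
      rw [Finset.card_erase_of_mem hv]; omega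
    obtain ⟨a, b, hsh, rfl⟩ := mem_fac.1 hv
    refine ⟨k, i, a, b, h0, h1, ?_, rfl⟩
    by_contra hf
    obtain ⟨l, j, l0, l1, hsub, hne⟩ := exists_neighbour hd i h0 h1 hsh hf
    have := huniq _ ((isFacet_cal_iff hd).2 (fac_mem_Facs l0 l1)) hsub
    exact hne (index_of_subset hd h0 h1 this.ge)
  · rintro ⟨k, i, a, b, h0, h1, hf, rfl⟩
    have hmem : pt i a b ∈ fac m k i := pt_mem_fac hf.1
    refine ⟨⟨?_, _, fac_mem_Facs h0 h1, Finset.erase_subset _ _⟩, _,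
      (isFacet_cal_iff hd).2 (fac_mem_Facs h0 h1), Finset.erase_subset _ _,
      (Finset.card_erase_add_one hmem).symm, ?_⟩
    · by_contra hne
      rw [Finset.not_nonempty_iff_eq_empty] at hne
      have e := index_of_erase_subset hd h0 h1 hf (l := k + 1) (j := i)
        (by rw [hne]; exact Finset.empty_subset _)
      omega
    · intro s' hs' hsub
      obtain ⟨l, j, _, _, rfl⟩ := (isFacet_cal_iff hd).1 hs'
      obtain ⟨rfl, rfl⟩ := index_of_erase_subset hd h0 h1 hf hsub
      rfl

/-- The faces of the boundary, in coordinates. -/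
theorem mem_faces_boundary_iff (hd : 2 ≤ d) {s : Finset (Vertex d)} :
    s ∈ (boundary (cal m d)).faces ↔ s.Nonempty ∧ ∃ (k : ℤ) (i : Vertex d) (a b : ℤ),
      0 ≤ k ∧ k ≤ d + 1 ∧ Free m d k a b ∧ s ⊆ (fac m k i).erase (pt i a b) := by
  constructor
  · rintro ⟨hs, t, ht, hst⟩
    obtain ⟨k, i, a, b, h0, h1, hf, rfl⟩ := (mem_boundaryFacets_iff hd).1 ht
    exact ⟨hs, k, i, a, b, h0, h1, hf, hst⟩
  · rintro ⟨hs, k, i, a, b, h0, h1, hf, hst⟩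
    exact ⟨hs, _, (mem_boundaryFacets_iff hd).2 ⟨k, i, a, b, h0, h1, hf, rfl⟩, hst⟩

end Boundary

/-! ### Automorphisms act on the boundary -/

section Automorphisms

variable {V : Type*} {X : PreAbstractSimplicialComplex V}

theorem map_inv_map (f : Equiv.Perm V) (s : Finset V) :
    (s.map (f⁻¹).toEmbedding).map f.toEmbedding = s := by
  ext x; simp only [Finset.mem_map]; simp

theorem map_map_inv (f : Equiv.Perm V) (s : Finset V) :
    (s.map f.toEmbedding).map (f⁻¹).toEmbedding = s := by
  simpa using map_inv_map f⁻¹ s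

theorem map_face {f : Equiv.Perm V} (hf : f ∈ Aut X) {s : Finset V} :
    s.map f.toEmbedding ∈ X.faces ↔ s ∈ X.faces := hf.2 s

theorem IsFacet.map {f : Equiv.Perm V} (hf : f ∈ Aut X) {s : Finset V} (hs : IsFacet X s) :
    IsFacet X (s.map f.toEmbedding) := by
  refine ⟨(map_face hf).2 hs.1, fun t ht hst => ?_⟩
  have := hs.2 (t.map (f⁻¹).toEmbedding) ((map_face ((Aut X).inv_mem hf)).2 ht) (by
    rw [← map_map_inv f s]; exact Finset.map_subset_map.2 hst)
  rw [← this, map_inv_map]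

theorem map_mem_boundaryFacets {f : Equiv.Perm V} (hf : f ∈ Aut X) {t : Finset V}
    (ht : t ∈ boundaryFacets X) : t.map f.toEmbedding ∈ boundaryFacets X := by
  obtain ⟨h1, s, hs, hts, hc, hu⟩ := ht
  refine ⟨(map_face hf).2 h1, _, hs.map hf, Finset.map_subset_map.2 hts, by simpa using hc, ?_⟩
  intro s' hs' hsub
  rw [← hu _ (hs'.map ((Aut X).inv_mem hf)) (by
    rw [← map_map_inv f t]; exact Finset.map_subset_map.2 hsub), map_inv_map]

theorem map_mem_faces_boundary {f : Equiv.Perm V} (hf : f ∈ Aut X) {s : Finset V}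
    (hs : s ∈ (boundary X).faces) : s.map f.toEmbedding ∈ (boundary X).faces := by
  obtain ⟨hne, t, ht, hst⟩ := hs
  exact ⟨hne.map, _, map_mem_boundaryFacets hf ht, Finset.map_subset_map.2 hst⟩

theorem aut_le_aut_boundary (hv : ∀ v, {v} ∈ (boundary X).faces) : Aut X ≤ Aut (boundary X) := by
  intro f hf
  refine ⟨fun v h => absurd (hv v) h, fun s => ⟨fun h => ?_, map_mem_faces_boundary hf⟩⟩
  have := map_mem_faces_boundary ((Aut X).inv_mem hf) h
  rwa [map_map_inv] at this

end Automorphisms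

/-! ### Simple edges as combinatorial invariants -/

section SimpleEdges

/-- An edge is simple if any two vertices of its link are joined in the link. -/
def SimpleEdge {V : Type*} (K : PreAbstractSimplicialComplex V) (x y : V) : Prop :=
  x ≠ y ∧ ∀ z w, (∃ s ∈ K.faces, x ∈ s ∧ y ∈ s ∧ z ∈ s) → (∃ s ∈ K.faces, x ∈ s ∧ y ∈ s ∧ w ∈ s) →
    ∃ s ∈ K.faces, x ∈ s ∧ y ∈ s ∧ z ∈ s ∧ w ∈ s

/-- A facet without simple edges. -/
def StiffFacet {V : Type*} (K : PreAbstractSimplicialComplex V) (t : Finset V) : Prop :=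
  IsFacet K t ∧ ∀ x ∈ t, ∀ y ∈ t, ¬ SimpleEdge K x y

variable {V : Type*} {K : PreAbstractSimplicialComplex V}

theorem SimpleEdge.symm {x y : V} (h : SimpleEdge K x y) : SimpleEdge K y x := by
  refine ⟨h.1.symm, ?_⟩
  rintro z w ⟨s, hs, hy, hx, hz⟩ ⟨t, ht, hy', hx', hw⟩
  obtain ⟨u, hu, h1, h2, h3⟩ := h.2 z w ⟨s, hs, hx, hy, hz⟩ ⟨t, ht, hx', hy', hw⟩
  exact ⟨u, hu, h2, h1, h3⟩

theorem SimpleEdge.map {f : Equiv.Perm V} (hf : f ∈ Aut K) {x y : V} (h : SimpleEdge K x y) :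
    SimpleEdge K (f x) (f y) := by
  have pull : ∀ z, (∃ s ∈ K.faces, f x ∈ s ∧ f y ∈ s ∧ z ∈ s) →
      ∃ s ∈ K.faces, x ∈ s ∧ y ∈ s ∧ f.symm z ∈ s := by
    rintro z ⟨s, hs, hx, hy, hz⟩
    refine ⟨_, (map_face ((Aut K).inv_mem hf)).2 hs, ?_, ?_, ?_⟩ <;>
      rw [Finset.mem_map_equiv, ← Equiv.Perm.inv_def, inv_inv]
    · exact hx
    · exact hy
    · simpa using hz
  refine ⟨fun e => h.1 (f.injective e), fun z w hz hw => ?_⟩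
  obtain ⟨s, hs, hx, hy, h1, h2⟩ := h.2 _ _ (pull z hz) (pull w hw)
  refine ⟨_, (map_face hf).2 hs, ?_, ?_, ?_, ?_⟩ <;> rw [Finset.mem_map_equiv] <;> simpa

theorem StiffFacet.map {f : Equiv.Perm V} (hf : f ∈ Aut K) {t : Finset V} (h : StiffFacet K t) :
    StiffFacet K (t.map f.toEmbedding) := by
  refine ⟨h.1.map hf, ?_⟩
  simp only [Finset.mem_map, Equiv.coe_toEmbedding]
  rintro _ ⟨x, hx, rfl⟩ _ ⟨y, hy, rfl⟩ hs
  have := hs.map ((Aut K).inv_mem hf)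
  simp only [Equiv.Perm.coe_inv, Equiv.symm_apply_apply] at this
  exact h.2 x hx y hy this

end SimpleEdges

/-! ### Translations are automorphisms -/

section Translations

variable {m : Bool} {d : ℕ}

theorem map_translation_fac (k : ℤ) (i c : Vertex d) :
    (fac m k i).map (Equiv.addRight c).toEmbedding = fac m k (i + c) := by
  ext x
  simp only [Finset.mem_map, mem_fac, Equiv.coe_toEmbedding, Equiv.coe_addRight]
  constructor
  · rintro ⟨_, ⟨a, b, h, rfl⟩, rfl⟩
    exact ⟨a, b, h, by unfold pt; ring⟩
  · rintro ⟨a, b, h, rfl⟩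
    exact ⟨_, ⟨a, b, h, rfl⟩, by unfold pt; ring⟩

theorem map_translation_mem_faces (c : Vertex d) {s : Finset (Vertex d)}
    (hs : s ∈ (cal m d).faces) : s.map (Equiv.addRight c).toEmbedding ∈ (cal m d).faces := by
  obtain ⟨hne, _, ⟨k, i, h0, h1, rfl⟩, hst⟩ := hs
  refine ⟨hne.map, fac m k (i + c), fac_mem_Facs h0 h1, ?_⟩
  rw [← map_translation_fac]
  exact Finset.map_subset_map.2 hst

theorem singleton_mem_faces_boundary (hd : 2 ≤ d) (v : Vertex d) :
    {v} ∈ (boundary (cal m d)).faces := by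
  refine (mem_faces_boundary_iff hd).2 ⟨Finset.singleton_nonempty v, 0, v, 2, 0, by omega, by omega,
    ⟨inShape_row (by omega) (by omega), by omega, by omega, by omega⟩, ?_⟩
  rw [Finset.singleton_subset_iff, Finset.mem_erase]
  refine ⟨fun e => ?_, self_mem_fac le_rfl (by omega) v⟩
  nth_rewrite 1 [← pt_zero v] at e
  have := pt_injOn_small e (abs_le.2 ⟨by omega, by omega⟩) (abs_le.2 ⟨by omega, by omega⟩)
  omega

theorem faces_boundary_subset {V : Type*} {X : PreAbstractSimplicialComplex V} {s : Finset V}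
    (h : s ∈ (boundary X).faces) : s ∈ X.faces := by
  obtain ⟨hne, t, ht, hst⟩ := h
  exact X.isRelLowerSet_faces ht.1 |>.2 hst hne

theorem translation_mem_aut (hd : 2 ≤ d) (c : Vertex d) : Equiv.addRight c ∈ Aut (cal m d) := by
  refine ⟨fun v hv => absurd (faces_boundary_subset (singleton_mem_faces_boundary hd v)) hv,
    fun s => ⟨fun h => ?_, map_translation_mem_faces c⟩⟩
  have := map_translation_mem_faces (-c) h
  rw [Finset.map_map] at this
  convert this
  ext x
  simp

end Translations

/-! ### Stiff facets of the boundary for d ≥ 3 -/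

section Stiff

variable {m : Bool} {d : ℕ}

theorem isFacet_boundary_iff (hd : 2 ≤ d) {t : Finset (Vertex d)} :
    IsFacet (boundary (cal m d)) t ↔ ∃ (k : ℤ) (i : Vertex d) (a b : ℤ), 0 ≤ k ∧ k ≤ d + 1 ∧
      Free m d k a b ∧ t = (fac m k i).erase (pt i a b) := by
  rw [← mem_boundaryFacets_iff hd]
  constructor
  · rintro ⟨⟨hne, u, hu, htu⟩, hmax⟩
    rw [← hmax u ⟨hne.mono htu, u, hu, Finset.Subset.refl _⟩ htu]
    exact hu
  · intro ht
    refine ⟨⟨((cal m d).isRelLowerSet_faces ht.1).1, t, ht, Finset.Subset.refl _⟩, ?_⟩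
    rintro u ⟨-, w, hw, huw⟩ htu
    obtain ⟨s, hs, hws, hc, -⟩ := hw.2
    obtain ⟨s', hs', hts', hc', hu'⟩ := ht.2
    obtain rfl := hu' s hs ((htu.trans huw).trans hws)
    have : t = w := Finset.eq_of_subset_of_card_le (htu.trans huw) (by omega)
    subst this
    exact huw.antisymm htu

/-- Three free points can not be covered by two. -/
theorem exists_free_avoiding (hd : 3 ≤ d) {k : ℤ} (hk : 1 ≤ k ∧ k ≤ d) (a₁ b₁ a₂ b₂ : ℤ) :
    ∃ a b, Free m d k a b ∧ ¬ (a₁ = a ∧ b₁ = b) ∧ ¬ (a₂ = a ∧ b₂ = b) := by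
  by_contra! hc
  have free : ∀ a b, InShape m d k a b → ¬ (a = d + 2 - k ∧ b = 0) → ¬ (a = 0 ∧ b = tip m d k) →
      ¬ (a₁ = a ∧ b₁ = b) → a₂ = a ∧ b₂ = b := by
    intro a b h h1 h2 h3
    exact hc a b ⟨h, by omega, by omega, fun _ => ⟨h1, h2⟩⟩ (fun e e' => h3 ⟨e, e'⟩)
  have row : ∀ a : ℤ, 2 ≤ a → a ≤ d + 1 - k → ¬ (a₁ = a ∧ b₁ = 0) → a₂ = a ∧ b₂ = 0 := by
    intro a h1 h2
    refine free a 0 (Or.inr (Or.inr ⟨hk.1, hk.2, Or.inr (Or.inl ⟨rfl, h1, by omega⟩)⟩))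
      (by omega) (by omega)
  have h0 := free 0 0 (Or.inr (Or.inr ⟨hk.1, hk.2, Or.inl ⟨rfl, rfl⟩⟩)) (by omega)
    (by unfold tip; split_ifs <;> omega)
  have col : ∀ b : ℤ, (if m then d + 3 - k ≤ b ∧ b ≤ d + 1 else 2 ≤ b ∧ b ≤ k) →
      ¬ (a₁ = 0 ∧ b₁ = b) → a₂ = 0 ∧ b₂ = b := by
    intro b hb
    refine free 0 b (Or.inr (Or.inr ⟨hk.1, hk.2, Or.inr (Or.inr ⟨rfl, ?_⟩)⟩)) (by omega) ?_
    · split_ifs at hb ⊢ <;> omega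
    · unfold tip; split_ifs at hb ⊢ <;> omega
  -- A hook has d free points: the corner, d - k on the horizontal arm and k - 1 on the vertical
  -- arm. For d ≥ 3 three of them are found among the corner and at most two points per arm.
  have r2 := row 2
  have r3 := row 3
  cases m <;> simp only [if_true, if_false, Bool.false_eq_true] at col
  · have c2 := col 2
    have c3 := col 3
    omega
  · have c2 := col (d + 1)
    have c3 := col d
    omega

theorem pt_mem_erase {k a b x y : ℤ} (i : Vertex d) (h : InShape m d k x y)
    (h' : InShape m d k a b) (hne : ¬ (x = a ∧ y = b)) :
    pt i x y ∈ (fac m k i).erase (pt i a b) := by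
  have hb := h.bounds
  have hb' := h'.bounds
  exact Finset.mem_erase.2 ⟨fun e => hne (pt_injOn_small e (abs_le.2 ⟨by omega, by omega⟩)
    (abs_le.2 ⟨by omega, by omega⟩)), pt_mem_fac h⟩

theorem erase_mem_faces (hd : 2 ≤ d) {k a b : ℤ} (h0 : 0 ≤ k) (h1 : k ≤ d + 1)
    (hf : Free m d k a b) (i : Vertex d) :
    (fac m k i).erase (pt i a b) ∈ (boundary (cal m d)).faces :=
  ((isFacet_boundary_iff hd).2 ⟨k, i, a, b, h0, h1, hf, rfl⟩).1

/-- The link of this edge lies within a single hook. Two link vertices miss some free point, and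
deleting that point from the hook leaves a common face. -/
theorem simpleEdge_tips (hd : 3 ≤ d) {k : ℤ} (hk : 1 ≤ k ∧ k ≤ d) (i : Vertex d) :
    SimpleEdge (boundary (cal m d)) (pt i (d + 2 - k) 0) (pt i 0 (tip m d k)) := by
  have ht : 0 ≤ tip m d k ∧ tip m d k ≤ d + 1 := by unfold tip; split_ifs <;> omega
  refine ⟨fun e => ?_, fun z w hz hw => ?_⟩
  · have := pt_injOn_small e (abs_le.2 ⟨by omega, by omega⟩) (abs_le.2 ⟨by omega, by omega⟩)
    omega
  · have key : ∀ z, (∃ s ∈ (boundary (cal m d)).faces, pt i (d + 2 - k) 0 ∈ s ∧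
        pt i 0 (tip m d k) ∈ s ∧ z ∈ s) → z ∈ fac m k i := by
      rintro z ⟨s, hs, h1, h2, h3⟩
      obtain ⟨_, l, j, a, b, l0, l1, hf, hs⟩ := (mem_faces_boundary_iff (by omega)).1 hs
      have hs := hs.trans (Finset.erase_subset _ _)
      obtain ⟨rfl, rfl⟩ := facet_of_tips (by omega) hk (hs h1) (hs h2)
      exact hs h3
    obtain ⟨a₁, b₁, h1, rfl⟩ := mem_fac.1 (key z hz)
    obtain ⟨a₂, b₂, h2, rfl⟩ := mem_fac.1 (key w hw)
    obtain ⟨a, b, hf, n1, n2⟩ := exists_free_avoiding (m := m) hd hk a₁ b₁ a₂ b₂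
    have n3 := hf.2.2.2 hk
    have mem : ∀ x y, InShape m d k x y → ¬ (x = a ∧ y = b) →
        pt i x y ∈ (fac m k i).erase (pt i a b) := fun x y h hne => pt_mem_erase i h hf.1 hne
    exact ⟨_, erase_mem_faces (by omega) (by omega) (by omega) hf i,
      mem _ _ (inShape_tip' hk) (by tauto), mem _ _ (inShape_tip hk) (by tauto),
      mem _ _ h1 (by tauto), mem _ _ h2 (by tauto)⟩

theorem pt_row_mem {a j : ℤ} (i : Vertex d) (ha : 0 ≤ a ∧ a ≤ d + 1) (hj : 2 ≤ j ∧ j ≤ d)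
    (hne : a ≠ j) : pt i a 0 ∈ (fac m 0 i).erase (pt i j 0) :=
  pt_mem_erase i (inShape_row ha.1 ha.2) (inShape_row (by omega) (by omega)) (by omega)

theorem pt_col_mem {a j : ℤ} (i : Vertex d) (ha : 0 ≤ a ∧ a ≤ d + 1) (hj : 2 ≤ j ∧ j ≤ d)
    (hne : a ≠ j) : pt i 0 a ∈ (fac m (d + 1) i).erase (pt i 0 j) :=
  pt_mem_erase i (inShape_col ha.1 ha.2) (inShape_col (by omega) (by omega)) (by omega)

theorem free_row {j : ℤ} (hj : 2 ≤ j ∧ j ≤ d) : Free m d 0 j 0 :=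
  ⟨inShape_row (by omega) (by omega), fun _ => hj, by omega, by omega⟩

theorem free_col {j : ℤ} (hj : 2 ≤ j ∧ j ≤ d) : Free m d (d + 1) 0 j :=
  ⟨inShape_col (by omega) (by omega), by omega, fun _ => hj, by omega⟩

/-- Two unjoined link vertices: for e ≤ d, the points (d+1, 0) and (-1, 0), too far apart for one
segment; for e = d + 1, the points (1, 0) of σ and (0, `tip m d 1`) of α_1. Having two punctures 2
and 3 to choose from is where d ≥ 3 enters for e ≤ d. -/
theorem not_simpleEdge_row (hd : 3 ≤ d) {e : ℤ} (he : 1 ≤ e ∧ e ≤ d + 1) (i : Vertex d) :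
    ¬ SimpleEdge (boundary (cal m d)) (pt i 0 0) (pt i e 0) := by
  rintro ⟨-, h⟩
  have rowface : ∀ (j : Vertex d) (c : ℤ), 2 ≤ c ∧ c ≤ d →
      (fac m 0 j).erase (pt j c 0) ∈ (boundary (cal m d)).faces := fun j c hc =>
    erase_mem_faces (by omega) (by omega) (by omega) (free_row hc) j
  rcases (by omega : e ≤ d ∨ e = d + 1) with he' | rfl
  · obtain ⟨c, hc, hne⟩ : ∃ c : ℤ, (2 ≤ c ∧ c ≤ d) ∧ c ≠ e := by
      by_cases h2 : e = 2
      · exact ⟨3, by omega, by omega⟩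
      · exact ⟨2, by omega, by omega⟩
    obtain ⟨c', hc', hne'⟩ : ∃ c : ℤ, (2 ≤ c ∧ c ≤ d) ∧ c ≠ e + 1 := by
      by_cases h2 : e = 1
      · exact ⟨3, by omega, by omega⟩
      · exact ⟨2, by omega, by omega⟩
    have shift : ∀ a : ℤ, -1 ≤ a ∧ a ≤ d → a + 1 ≠ c' →
        pt i a 0 ∈ (fac m 0 (pt i (-1) 0)).erase (pt (pt i (-1) 0) c' 0) := by
      intro a ha hne
      have := pt_row_mem (m := m) (pt i (-1) 0) (a := a + 1) (by omega) hc' hne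
      rwa [pt_pt i (-1) 0 (a + 1) 0, show -1 + (a + 1) = a by ring, add_zero] at this
    obtain ⟨s, hs, h0, h1, h2, h3⟩ := h (pt i (d + 1) 0) (pt i (-1) 0)
      ⟨_, rowface i c hc, pt_row_mem i (by omega) hc (by omega),
        pt_row_mem i (by omega) hc (by omega), pt_row_mem i (by omega) hc (by omega)⟩
      ⟨_, rowface (pt i (-1) 0) c' hc', shift 0 (by omega) (by omega),
        shift e (by omega) (by omega), shift (-1) (by omega) (by omega)⟩
    obtain ⟨_, k, j, a, b, k0, k1, -, hsub⟩ := (mem_faces_boundary_iff (by omega)).1 hs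
    replace hsub := hsub.trans (Finset.erase_subset _ _)
    obtain ⟨rfl, -⟩ := facet_of_row_ends (by omega) (hsub h0) (hsub h2)
    obtain ⟨x, y, hxy, e3⟩ := mem_fac.1 (hsub h3)
    have hb := hxy.bounds
    have := small_relations (pt_eq_pt_iff.1 e3) (abs_le.2 ⟨by omega, by omega⟩)
      (abs_le.2 ⟨by omega, by omega⟩)
    omega
  · have f1 : Free m d 1 2 0 := by
      refine ⟨Or.inr (Or.inr ⟨le_rfl, by omega, Or.inr (Or.inl ⟨rfl, by omega, by omega⟩)⟩),
        by omega, by omega, by omega⟩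
    have ht : 2 ≤ tip m d 1 ∧ tip m d 1 ≤ d + 1 := by unfold tip; split_ifs <;> omega
    have hk : (1 : ℤ) ≤ 1 ∧ (1 : ℤ) ≤ d := by omega
    obtain ⟨s, hs, h0, h1, h2, h3⟩ := h (pt i 1 0) (pt i 0 (tip m d 1))
      ⟨_, rowface i 2 (by omega), pt_row_mem i (by omega) (by omega) (by omega),
        pt_row_mem i (by omega) (by omega) (by omega), pt_row_mem i (by omega) (by omega) (by omega)⟩
      ⟨_, erase_mem_faces (by omega) (by omega) (by omega) f1 i,
        pt_mem_erase i (Or.inr (Or.inr ⟨hk.1, hk.2, Or.inl ⟨rfl, rfl⟩⟩)) f1.1 (by omega),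
        pt_mem_erase i (Or.inr (Or.inr ⟨hk.1, hk.2, Or.inr (Or.inl ⟨rfl, by omega, by omega⟩)⟩))
          f1.1 (by omega),
        pt_mem_erase i (inShape_tip hk) f1.1 (by omega)⟩
    obtain ⟨_, k, j, a, b, k0, k1, -, hsub⟩ := (mem_faces_boundary_iff (by omega)).1 hs
    replace hsub := hsub.trans (Finset.erase_subset _ _)
    obtain ⟨rfl, rfl⟩ := index_of_row (by omega) (hsub h0) (hsub h2) (hsub h1)
    have := (pt_mem_fac_iff (by omega) (by omega)).1 (hsub h3)
    unfold InShape at this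
    omega

/-- As for rows; for e = d + 1 the unjoined link vertices are (0, 1) of μ and (2, 0) of α_d. -/
theorem not_simpleEdge_col (hd : 3 ≤ d) {e : ℤ} (he : 1 ≤ e ∧ e ≤ d + 1) (i : Vertex d) :
    ¬ SimpleEdge (boundary (cal m d)) (pt i 0 0) (pt i 0 e) := by
  rintro ⟨-, h⟩
  have colface : ∀ (j : Vertex d) (c : ℤ), 2 ≤ c ∧ c ≤ d →
      (fac m (d + 1) j).erase (pt j 0 c) ∈ (boundary (cal m d)).faces := fun j c hc =>
    erase_mem_faces (by omega) (by omega) (by omega) (free_col hc) j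
  rcases (by omega : e ≤ d ∨ e = d + 1) with he' | rfl
  · obtain ⟨c, hc, hne⟩ : ∃ c : ℤ, (2 ≤ c ∧ c ≤ d) ∧ c ≠ e := by
      by_cases h2 : e = 2
      · exact ⟨3, by omega, by omega⟩
      · exact ⟨2, by omega, by omega⟩
    obtain ⟨c', hc', hne'⟩ : ∃ c : ℤ, (2 ≤ c ∧ c ≤ d) ∧ c ≠ e + 1 := by
      by_cases h2 : e = 1
      · exact ⟨3, by omega, by omega⟩
      · exact ⟨2, by omega, by omega⟩
    have shift : ∀ a : ℤ, -1 ≤ a ∧ a ≤ d → a + 1 ≠ c' →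
        pt i 0 a ∈ (fac m (d + 1) (pt i 0 (-1))).erase (pt (pt i 0 (-1)) 0 c') := by
      intro a ha hne
      have := pt_col_mem (m := m) (pt i 0 (-1)) (a := a + 1) (by omega) hc' hne
      rwa [pt_pt i 0 (-1) 0 (a + 1), show -1 + (a + 1) = a by ring, add_zero] at this
    obtain ⟨s, hs, h0, h1, h2, h3⟩ := h (pt i 0 (d + 1)) (pt i 0 (-1))
      ⟨_, colface i c hc, pt_col_mem i (by omega) hc (by omega),
        pt_col_mem i (by omega) hc (by omega), pt_col_mem i (by omega) hc (by omega)⟩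
      ⟨_, colface (pt i 0 (-1)) c' hc', shift 0 (by omega) (by omega),
        shift e (by omega) (by omega), shift (-1) (by omega) (by omega)⟩
    obtain ⟨_, k, j, a, b, k0, k1, -, hsub⟩ := (mem_faces_boundary_iff (by omega)).1 hs
    replace hsub := hsub.trans (Finset.erase_subset _ _)
    obtain ⟨rfl, -⟩ := facet_of_col_ends (by omega) (hsub h0) (hsub h2)
    obtain ⟨x, y, hxy, e3⟩ := mem_fac.1 (hsub h3)
    have hb := hxy.bounds
    have := small_relations (pt_eq_pt_iff.1 e3) (abs_le.2 ⟨by omega, by omega⟩)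
      (abs_le.2 ⟨by omega, by omega⟩)
    omega
  · have hk : (1 : ℤ) ≤ d ∧ (d : ℤ) ≤ d := by omega
    -- The vertical tip of α_d is (0, 2) in the first family and (0, d+1) in the second, so (0, 3)
    -- is free in both.
    have f1 : Free m d d 0 3 := by
      refine ⟨Or.inr (Or.inr ⟨hk.1, hk.2, Or.inr (Or.inr ⟨rfl, ?_⟩)⟩),
        by omega, by omega, fun _ => ⟨by omega, ?_⟩⟩
      · split_ifs <;> omega
      · unfold tip; split_ifs <;> omega
    have hlast : InShape m d d 0 (d + 1) := by
      refine Or.inr (Or.inr ⟨hk.1, hk.2, Or.inr (Or.inr ⟨rfl, ?_⟩)⟩)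
      split_ifs <;> omega
    obtain ⟨s, hs, h0, h1, h2, h3⟩ := h (pt i 0 1) (pt i 2 0)
      ⟨_, colface i 2 (by omega), pt_col_mem i (by omega) (by omega) (by omega),
        pt_col_mem i (by omega) (by omega) (by omega), pt_col_mem i (by omega) (by omega) (by omega)⟩
      ⟨_, erase_mem_faces (by omega) (by omega) (by omega) f1 i,
        pt_mem_erase i (Or.inr (Or.inr ⟨hk.1, hk.2, Or.inl ⟨rfl, rfl⟩⟩)) f1.1 (by omega),
        pt_mem_erase i hlast f1.1 (by omega),
        pt_mem_erase i (Or.inr (Or.inr ⟨hk.1, hk.2, Or.inr (Or.inl ⟨rfl, by omega, by omega⟩)⟩))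
          f1.1 (by omega)⟩
    obtain ⟨_, k, j, a, b, k0, k1, -, hsub⟩ := (mem_faces_boundary_iff (by omega)).1 hs
    replace hsub := hsub.trans (Finset.erase_subset _ _)
    obtain ⟨rfl, rfl⟩ := index_of_col (by omega) (hsub h0) (hsub h2) (hsub h1)
    have := (pt_mem_fac_iff (by omega) (by omega)).1 (hsub h3)
    unfold InShape at this
    omega

theorem stiffFacet_boundary_iff (hd : 3 ≤ d) {t : Finset (Vertex d)} :
    StiffFacet (boundary (cal m d)) t ↔ ∃ (i : Vertex d) (j : ℤ), (2 ≤ j ∧ j ≤ d) ∧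
      (t = (fac m 0 i).erase (pt i j 0) ∨ t = (fac m (d + 1) i).erase (pt i 0 j)) := by
  constructor
  · rintro ⟨ht, hno⟩
    obtain ⟨k, i, a, b, k0, k1, hf, rfl⟩ := (isFacet_boundary_iff (by omega)).1 ht
    have hs := hf.1
    rcases (by omega : k = 0 ∨ k = d + 1 ∨ (1 ≤ k ∧ k ≤ d)) with rfl | rfl | hk
    · obtain rfl : b = 0 := by unfold InShape at hs; omega
      exact ⟨i, a, hf.2.1 rfl, Or.inl rfl⟩
    · obtain rfl : a = 0 := by unfold InShape at hs; omega
      exact ⟨i, b, hf.2.2.1 rfl, Or.inr rfl⟩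
    · have := hf.2.2.2 hk
      exact absurd (simpleEdge_tips hd hk i) (hno _ (pt_mem_erase i (inShape_tip' hk) hs (by tauto))
        _ (pt_mem_erase i (inShape_tip hk) hs (by tauto)))
  · rintro ⟨i, j, hj, rfl | rfl⟩
    · refine ⟨(isFacet_boundary_iff (by omega)).2
        ⟨0, i, j, 0, by omega, by omega, free_row hj, rfl⟩, ?_⟩
      have key : ∀ a a' : ℤ, 0 ≤ a → a < a' → a' ≤ d + 1 →
          ¬ SimpleEdge (boundary (cal m d)) (pt i a 0) (pt i a' 0) := by
        intro a a' h0 h1 h2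
        have := not_simpleEdge_row (m := m) hd (e := a' - a) (by omega) (pt i a 0)
        simpa [pt_pt] using this
      intro x hx y hy hs
      obtain ⟨a, b, h1, rfl⟩ := mem_fac.1 (Finset.mem_of_mem_erase hx)
      obtain ⟨a', b', h2, rfl⟩ := mem_fac.1 (Finset.mem_of_mem_erase hy)
      have hb := h1.bounds
      have hb' := h2.bounds
      obtain ⟨rfl, rfl⟩ : b = 0 ∧ b' = 0 := by unfold InShape at h1 h2; omega
      rcases lt_trichotomy a a' with h | rfl | h
      · exact key a a' (by omega) h (by omega) hs
      · exact hs.1 rfl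
      · exact key a' a (by omega) h (by omega) hs.symm
    · refine ⟨(isFacet_boundary_iff (by omega)).2
        ⟨d + 1, i, 0, j, by omega, by omega, free_col hj, rfl⟩, ?_⟩
      have key : ∀ a a' : ℤ, 0 ≤ a → a < a' → a' ≤ d + 1 →
          ¬ SimpleEdge (boundary (cal m d)) (pt i 0 a) (pt i 0 a') := by
        intro a a' h0 h1 h2
        have := not_simpleEdge_col (m := m) hd (e := a' - a) (by omega) (pt i 0 a)
        simpa [pt_pt] using this
      intro x hx y hy hs
      obtain ⟨a, b, h1, rfl⟩ := mem_fac.1 (Finset.mem_of_mem_erase hx)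
      obtain ⟨a', b', h2, rfl⟩ := mem_fac.1 (Finset.mem_of_mem_erase hy)
      have hb := h1.bounds
      have hb' := h2.bounds
      obtain ⟨rfl, rfl⟩ : a = 0 ∧ a' = 0 := by unfold InShape at h1 h2; omega
      rcases lt_trichotomy b b' with h | rfl | h
      · exact key b b' (by omega) h (by omega) hs
      · exact hs.1 rfl
      · exact key b' b (by omega) h (by omega) hs.symm

end Stiff

/-! ### Horizontal and vertical lines -/

section Lines

variable {d : ℕ}

/-- The `a`-th point of the line through `i` in one of the two distinguished directions. -/
def line (o : Bool) (i : Vertex d) (a : ℤ) : Vertex d := if o then pt i a 0 else pt i 0 a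

theorem line_line (o : Bool) (i : Vertex d) (a b : ℤ) :
    line o (line o i a) b = line o i (a + b) := by
  unfold line; split_ifs <;> rw [pt_pt] <;> simp

@[simp] theorem line_zero (o : Bool) (i : Vertex d) : line o i 0 = i := by
  unfold line; split_ifs <;> simp

theorem eq_line_neg {o : Bool} {i x : Vertex d} {a : ℤ} (h : x = line o i a) :
    i = line o x (-a) := by
  rw [h, line_line]; simp

theorem line_inj {o : Bool} {i : Vertex d} {a b : ℤ} (h : line o i a = line o i b)
    (hab : |a - b| ≤ 2 * d + 2) : a = b := by
  unfold line at h
  split_ifs at h <;> rw [pt_eq_pt_iff] at h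
  · have := small_relations h hab (abs_le.2 ⟨by omega, by omega⟩)
    omega
  · have := small_relations h (abs_le.2 ⟨by omega, by omega⟩) hab
    omega

theorem direction_eq {o o' : Bool} {i : Vertex d} {a b : ℤ} (h : line o i a = line o' i b)
    (ha : |a| ≤ d + 1) (hb : |b| ≤ d + 1) (h0 : a ≠ 0) : o = o' := by
  rw [abs_le] at ha hb
  cases o <;> cases o' <;> try rfl
  all_goals
    simp only [line, if_true, if_false, Bool.false_eq_true] at h
    rw [pt_eq_pt_iff] at h
    have := small_relations h (abs_le.2 ⟨by omega, by omega⟩) (abs_le.2 ⟨by omega, by omega⟩)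
    omega

/-- Equal unit steps in both directions do not lead to a point of an axis. -/
theorem line_line_ne (hd : 1 ≤ d) {o : Bool} {i : Vertex d} {s e : ℤ} (hs : s = 1 ∨ s = -1)
    (he : |e| ≤ d + 1) : line false (line true i s) s ≠ line o i e := by
  intro h
  rw [abs_le] at he
  simp only [line, if_true, if_false, Bool.false_eq_true, pt_pt] at h
  split_ifs at h <;> rw [pt_eq_pt_iff] at h
  all_goals
    have := small_relations h (abs_le.2 ⟨by omega, by omega⟩) (abs_le.2 ⟨by omega, by omega⟩)
    omega

end Lines

/-! ### Rigidity of the boundary for d ≥ 3 -/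

section Rigidity

variable {m : Bool} {d : ℕ}

theorem stiffFacet_iff_line (hd : 3 ≤ d) {t : Finset (Vertex d)} :
    StiffFacet (boundary (cal m d)) t ↔ ∃ (o : Bool) (i : Vertex d) (j : ℤ), (2 ≤ j ∧ j ≤ d) ∧
      ∀ x, x ∈ t ↔ ∃ a : ℤ, 0 ≤ a ∧ a ≤ d + 1 ∧ a ≠ j ∧ x = line o i a := by
  have row : ∀ (i : Vertex d) (j : ℤ), 2 ≤ j ∧ j ≤ d → ∀ x, x ∈ (fac m 0 i).erase (pt i j 0) ↔
      ∃ a : ℤ, 0 ≤ a ∧ a ≤ d + 1 ∧ a ≠ j ∧ x = line true i a := by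
    intro i j hj x
    simp only [line, if_true]
    constructor
    · intro hx
      obtain ⟨hne, hx⟩ := Finset.mem_erase.1 hx
      obtain ⟨a, b, h, rfl⟩ := mem_fac.1 hx
      have hb := h.bounds
      obtain rfl : b = 0 := by unfold InShape at h; omega
      exact ⟨a, by omega, by omega, fun e => hne (by rw [e]), rfl⟩
    · rintro ⟨a, h0, h1, h2, rfl⟩
      exact pt_row_mem i ⟨h0, h1⟩ hj h2
  have col : ∀ (i : Vertex d) (j : ℤ), 2 ≤ j ∧ j ≤ d →
      ∀ x, x ∈ (fac m (d + 1) i).erase (pt i 0 j) ↔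
      ∃ a : ℤ, 0 ≤ a ∧ a ≤ d + 1 ∧ a ≠ j ∧ x = line false i a := by
    intro i j hj x
    simp only [line, if_false, Bool.false_eq_true]
    constructor
    · intro hx
      obtain ⟨hne, hx⟩ := Finset.mem_erase.1 hx
      obtain ⟨a, b, h, rfl⟩ := mem_fac.1 hx
      have hb := h.bounds
      obtain rfl : a = 0 := by unfold InShape at h; omega
      exact ⟨b, by omega, by omega, fun e => hne (by rw [e]), rfl⟩
    · rintro ⟨a, h0, h1, h2, rfl⟩
      exact pt_col_mem i ⟨h0, h1⟩ hj h2
  rw [stiffFacet_boundary_iff hd]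
  constructor
  · rintro ⟨i, j, hj, rfl | rfl⟩
    · exact ⟨true, i, j, hj, row i j hj⟩
    · exact ⟨false, i, j, hj, col i j hj⟩
  · rintro ⟨o, i, j, hj, h⟩
    refine ⟨i, j, hj, ?_⟩
    cases o
    · exact Or.inr (Finset.ext fun x => (h x).trans (col i j hj x).symm)
    · exact Or.inl (Finset.ext fun x => (h x).trans (row i j hj x).symm)

open Classical in
theorem exists_stiffFacet_line (hd : 3 ≤ d) (o : Bool) (i : Vertex d) {j : ℤ}
    (hj : 2 ≤ j ∧ j ≤ d) : ∃ t, StiffFacet (boundary (cal m d)) t ∧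
      ∀ x, x ∈ t ↔ ∃ a : ℤ, 0 ≤ a ∧ a ≤ d + 1 ∧ a ≠ j ∧ x = line o i a := by
  have h : ∀ x, x ∈ ((Finset.Icc (0 : ℤ) (d + 1)).erase j).image (line o i) ↔
      ∃ a : ℤ, 0 ≤ a ∧ a ≤ d + 1 ∧ a ≠ j ∧ x = line o i a := by
    intro x
    simp only [Finset.mem_image, Finset.mem_erase, Finset.mem_Icc]
    constructor
    · rintro ⟨a, ⟨h1, h2, h3⟩, rfl⟩; exact ⟨a, h2, h3, h1, rfl⟩
    · rintro ⟨a, h2, h3, h1, rfl⟩; exact ⟨a, ⟨h1, h2, h3⟩, rfl⟩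
  exact ⟨_, (stiffFacet_iff_line hd).2 ⟨o, i, j, hj, h⟩, h⟩

/-- Three vertices lie in a common stiff facet. -/
def Joined (K : PreAbstractSimplicialComplex (Vertex d)) (x y z : Vertex d) : Prop :=
  ∃ t, StiffFacet K t ∧ x ∈ t ∧ y ∈ t ∧ z ∈ t

theorem Joined.map {K : PreAbstractSimplicialComplex (Vertex d)} {f : Equiv.Perm (Vertex d)}
    (hf : f ∈ Aut K) {x y z : Vertex d} (h : Joined K x y z) : Joined K (f x) (f y) (f z) := by
  obtain ⟨t, ht, hx, hy, hz⟩ := h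
  exact ⟨_, ht.map hf, by simpa, by simpa, by simpa⟩

theorem Joined.swap {K : PreAbstractSimplicialComplex (Vertex d)} {x y z : Vertex d}
    (h : Joined K x y z) : Joined K y x z := by
  obtain ⟨t, ht, hx, hy, hz⟩ := h
  exact ⟨t, ht, hy, hx, hz⟩

theorem exists_line_of_joined (hd : 3 ≤ d) {x y z : Vertex d}
    (h : Joined (boundary (cal m d)) x y z) : ∃ o e, |e| ≤ (d : ℤ) + 1 ∧ y = line o x e := by
  obtain ⟨t, ht, hx, hy, -⟩ := h
  obtain ⟨o, i, j, hj, ht⟩ := (stiffFacet_iff_line hd).1 ht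
  obtain ⟨a, a0, a1, -, hx⟩ := (ht x).1 hx
  obtain ⟨b, b0, b1, -, rfl⟩ := (ht y).1 hy
  refine ⟨o, b - a, abs_le.2 ⟨by omega, by omega⟩, ?_⟩
  rw [eq_line_neg hx, line_line]; congr 1; ring

theorem line_of_joined (hd : 3 ≤ d) {o : Bool} {x z : Vertex d} {e : ℤ}
    (he : 1 ≤ e ∧ e ≤ d + 1) (h : Joined (boundary (cal m d)) x (line o x e) z) :
    ∃ a : ℤ, e - d - 1 ≤ a ∧ a ≤ d + 1 ∧ z = line o x a := by
  obtain ⟨t, ht, hx, hy, hz⟩ := h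
  obtain ⟨o', i, j, hj, ht⟩ := (stiffFacet_iff_line hd).1 ht
  obtain ⟨a, a0, a1, -, hx⟩ := (ht _).1 hx
  obtain ⟨b, b0, b1, -, hy⟩ := (ht _).1 hy
  obtain ⟨c, c0, c1, -, hz⟩ := (ht _).1 hz
  rw [eq_line_neg hx, line_line] at hy hz
  obtain rfl := direction_eq hy (abs_le.2 ⟨by omega, by omega⟩) (abs_le.2 ⟨by omega, by omega⟩)
    (by omega)
  have := line_inj hy (abs_le.2 ⟨by omega, by omega⟩)
  exact ⟨-a + c, by omega, by omega, hz⟩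

theorem joined_unit (hd : 3 ≤ d) (o : Bool) (x : Vertex d) {a : ℤ} (ha : -d ≤ a ∧ a ≤ d + 1)
    (h0 : a ≠ 0) (_h1 : a ≠ 1) : Joined (boundary (cal m d)) x (line o x 1) (line o x a) := by
  -- The vertex x is placed at position s of a segment punctured at j. Starting the segment at the
  -- lower of x and the target and puncturing at 2 works unless a is -1, -2 or 2.
  have key : ∀ s j : ℤ, (2 ≤ j ∧ j ≤ d) → (0 ≤ s ∧ s ≤ d ∧ 0 ≤ s + a ∧ s + a ≤ d + 1) →
      s ≠ j → s + 1 ≠ j → s + a ≠ j →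
      Joined (boundary (cal m d)) x (line o x 1) (line o x a) := by
    intro s j hj hs n0 n1 na
    obtain ⟨t, ht, hmem⟩ := exists_stiffFacet_line (m := m) hd o (line o x (-s)) hj
    refine ⟨t, ht, (hmem _).2 ⟨s, by omega, by omega, n0, ?_⟩,
      (hmem _).2 ⟨s + 1, by omega, by omega, n1, ?_⟩,
      (hmem _).2 ⟨s + a, by omega, by omega, na, ?_⟩⟩ <;> rw [line_line] <;> simp
  by_cases ha1 : a = -1
  · exact key 1 3 (by omega) (by omega) (by omega) (by omega) (by omega)
  by_cases ha2 : a = -2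
  · exact key 3 2 (by omega) (by omega) (by omega) (by omega) (by omega)
  by_cases ha3 : a = 2
  · exact key 0 3 (by omega) (by omega) (by omega) (by omega) (by omega)
  rcases lt_or_gt_of_ne h0 with h | h
  · exact key (-a) 2 (by omega) (by omega) (by omega) (by omega) (by omega)
  · exact key 0 2 (by omega) (by omega) (by omega) (by omega) (by omega)

/-- The vertices joined to the pair `x`, `y`. -/
def jointLink (K : PreAbstractSimplicialComplex (Vertex d)) (x y : Vertex d) : Set (Vertex d) :=
  {z | z ≠ x ∧ z ≠ y ∧ Joined K x y z}

instance : NeZero (vertexCount d) := ⟨by simp [vertexCount]⟩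

theorem ncard_jointLink_map {K : PreAbstractSimplicialComplex (Vertex d)}
    {f : Equiv.Perm (Vertex d)} (hf : f ∈ Aut K) (x y : Vertex d) :
    (jointLink K x y).ncard ≤ (jointLink K (f x) (f y)).ncard := by
  rw [← Set.ncard_image_of_injective _ f.injective]
  refine Set.ncard_le_ncard ?_ (Set.toFinite _)
  rintro _ ⟨z, ⟨h1, h2, h3⟩, rfl⟩
  exact ⟨fun e => h1 (f.injective e), fun e => h2 (f.injective e), h3.map hf⟩

theorem ncard_jointLink_swap (K : PreAbstractSimplicialComplex (Vertex d)) (x y : Vertex d) :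
    (jointLink K x y).ncard = (jointLink K y x).ncard := by
  congr 1
  ext z
  exact ⟨fun h => ⟨h.2.1, h.1, h.2.2.swap⟩, fun h => ⟨h.2.1, h.1, h.2.2.swap⟩⟩

/-- Segments through positions 0 and e stay within [e - d - 1, d + 1]. The bound drops below 2d as
soon as e ≥ 2, while unit pairs attain 2d by `le_ncard_jointLink`. -/
theorem ncard_jointLink_le (hd : 3 ≤ d) (o : Bool) (x : Vertex d) {e : ℤ}
    (he : 1 ≤ e ∧ e ≤ d + 1) :
    ((jointLink (boundary (cal m d)) x (line o x e)).ncard : ℤ) ≤ 2 * d + 1 - e := by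
  classical
  have hsub : jointLink (boundary (cal m d)) x (line o x e) ⊆
      ((((Finset.Icc (e - d - 1) (d + 1)).erase 0).erase e).image (line o x) : Finset _) := by
    rintro z ⟨h1, h2, h3⟩
    obtain ⟨a, a0, a1, rfl⟩ := line_of_joined hd he h3
    refine Finset.mem_coe.2 (Finset.mem_image.2 ⟨a, ?_, rfl⟩)
    simp only [Finset.mem_erase, Finset.mem_Icc]
    exact ⟨fun h => h2 (by rw [h]), fun h => h1 (by rw [h, line_zero]), a0, a1⟩
  have h1 := Set.ncard_le_ncard hsub (Set.toFinite _)
  rw [Set.ncard_coe_finset] at h1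
  have h2 := h1.trans Finset.card_image_le
  rw [Finset.card_erase_of_mem (by simp only [Finset.mem_erase, Finset.mem_Icc]; omega),
    Finset.card_erase_of_mem (by simp only [Finset.mem_Icc]; omega), Int.card_Icc] at h2
  omega

theorem le_ncard_jointLink (hd : 3 ≤ d) (o : Bool) (x : Vertex d) :
    2 * d ≤ (jointLink (boundary (cal m d)) x (line o x 1)).ncard := by
  classical
  have hsub : (((((Finset.Icc (-(d : ℤ)) (d + 1)).erase 0).erase 1).image (line o x) :
      Finset (Vertex d)) : Set (Vertex d)) ⊆ jointLink (boundary (cal m d)) x (line o x 1) := by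
    intro z hz
    obtain ⟨a, ha, rfl⟩ := Finset.mem_image.1 (Finset.mem_coe.1 hz)
    simp only [Finset.mem_erase, Finset.mem_Icc] at ha
    refine ⟨fun h => ha.2.1 ?_, fun h => ha.1 ?_, joined_unit hd o x ha.2.2 ha.2.1 ha.1⟩
    · nth_rewrite 2 [← line_zero o x] at h
      exact line_inj h (abs_le.2 ⟨by omega, by omega⟩)
    · exact line_inj h (abs_le.2 ⟨by omega, by omega⟩)
  have h1 := Set.ncard_le_ncard hsub (Set.toFinite _)
  rw [Set.ncard_coe_finset, Finset.card_image_of_injOn] at h1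
  · rw [Finset.card_erase_of_mem (by simp only [Finset.mem_erase, Finset.mem_Icc]; omega),
      Finset.card_erase_of_mem (by simp only [Finset.mem_Icc]; omega), Int.card_Icc] at h1
    omega
  · intro a ha b hb h
    simp only [Finset.mem_coe, Finset.mem_erase, Finset.mem_Icc] at ha hb
    exact line_inj h (abs_le.2 ⟨by omega, by omega⟩)

variable {f : Equiv.Perm (Vertex d)}

theorem map_unit_step (hd : 3 ≤ d) (hf : f ∈ Aut (boundary (cal m d))) (o : Bool) (x : Vertex d) :
    ∃ (o' : Bool) (s : ℤ), (s = 1 ∨ s = -1) ∧ f (line o x 1) = line o' (f x) s := by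
  have hj := (joined_unit (m := m) hd o x (a := 2) (by omega) (by omega) (by omega)).map hf
  obtain ⟨o', e, he, h⟩ := exists_line_of_joined hd hj
  rw [abs_le] at he
  refine ⟨o', e, ?_, h⟩
  have hcard := (le_ncard_jointLink (m := m) hd o x).trans (ncard_jointLink_map hf x (line o x 1))
  have hne : e ≠ 0 := by
    rintro rfl
    rw [line_zero] at h
    have h' := f.injective h
    nth_rewrite 2 [← line_zero o x] at h'
    have := line_inj h' (abs_le.2 ⟨by omega, by omega⟩)
    omega
  rcases lt_or_gt_of_ne hne with hneg | hpos
  · rw [ncard_jointLink_swap] at hcard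
    nth_rewrite 1 [eq_line_neg h] at hcard
    have := ncard_jointLink_le (m := m) hd o' (f (line o x 1)) (e := -e) (by omega)
    omega
  · rw [h] at hcard
    have := ncard_jointLink_le (m := m) hd o' (f x) (e := e) (by omega)
    omega

/-- Three consecutive points lie in a punctured segment, hence so do their images, which fixes the
direction; turning back would contradict injectivity. -/
theorem map_next_step (hd : 3 ≤ d) (hf : f ∈ Aut (boundary (cal m d))) {o o' : Bool}
    {x : Vertex d} {s : ℤ} (hs : s = 1 ∨ s = -1) (h : f (line o x 1) = line o' (f x) s) :
    f (line o x 2) = line o' (f (line o x 1)) s := by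
  obtain ⟨o'', s', hs', h'⟩ := map_unit_step hd hf o (line o x 1)
  rw [line_line] at h'
  norm_num at h'
  have hj := (joined_unit (m := m) hd o x (a := 2) (by omega) (by omega) (by omega)).map hf
  have ho : o'' = o' := by
    obtain ⟨a, ha, e⟩ : ∃ a : ℤ, |a| ≤ d + 1 ∧ f (line o x 2) = line o' (f (line o x 1)) a := by
      -- `line_of_joined` needs a positive offset, so for s = -1 the pair is read from its other
      -- end.
      rcases hs with rfl | rfl
      · rw [h] at hj
        obtain ⟨a, a0, a1, e⟩ := line_of_joined hd (by omega) hj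
        refine ⟨a - 1, abs_le.2 ⟨by omega, by omega⟩, ?_⟩
        rw [e, h, line_line]; congr 1; ring
      · have hj' := hj.swap
        nth_rewrite 1 [eq_line_neg h] at hj'
        obtain ⟨a, a0, a1, e⟩ := line_of_joined hd (by omega) hj'
        exact ⟨a, abs_le.2 ⟨by omega, by omega⟩, e⟩
    rw [h'] at e
    exact direction_eq e (abs_le.2 ⟨by omega, by omega⟩) ha (by omega)
  subst ho
  have : s' = s := by
    by_contra hne
    have hz : s + s' = 0 := by omega
    rw [h, line_line, hz, line_zero] at h'
    have e := f.injective h'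
    nth_rewrite 2 [← line_zero o x] at e
    have := line_inj e (abs_le.2 ⟨by omega, by omega⟩)
    omega
  rw [h', this]

theorem map_line (hd : 3 ≤ d) (hf : f ∈ Aut (boundary (cal m d))) :
    ∃ (o : Bool) (s : ℤ), (s = 1 ∨ s = -1) ∧
      ∀ k : ℕ, f (line true 0 k) = line o (f 0) (s * k) := by
  obtain ⟨o, s, hs, h⟩ := map_unit_step hd hf true 0
  refine ⟨o, s, hs, ?_⟩
  have step : ∀ k : ℕ, f (line true 0 (k + 1 : ℕ)) = line o (f (line true 0 k)) s := by
    intro k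
    induction k with
    | zero => simpa using h
    | succ k ih =>
      have e1 : line true (line true (0 : Vertex d) k) 1 = line true 0 (k + 1 : ℕ) := by
        rw [line_line]; push_cast; rfl
      have e2 : line true (line true (0 : Vertex d) k) 2 = line true 0 (k + 1 + 1 : ℕ) := by
        rw [line_line]; push_cast; congr 1
      have := map_next_step hd hf hs (x := line true 0 k) (o := true) (by rw [e1]; exact ih)
      rwa [e1, e2] at this
  intro k
  induction k with
  | zero => simp
  | succ k ih => rw [step, ih, line_line]; congr 1; push_cast; ring

theorem map_affine (hd : 3 ≤ d) (hf : f ∈ Aut (boundary (cal m d))) :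
    ∃ (o : Bool) (s : ℤ), (s = 1 ∨ s = -1) ∧
      ∀ x, f x = f 0 + s * (if o then 1 else (d : Vertex d) + 3) * x := by
  obtain ⟨o, s, hs, h⟩ := map_line hd hf
  refine ⟨o, s, hs, fun x => ?_⟩
  have := h (-x).val
  -- Position k on the horizontal line through 0 is the vertex -k.
  have e : line true (0 : Vertex d) ((-x).val : ℤ) = x := by
    simp [line, pt]
  rw [e] at this
  rw [this]
  cases o
  · simp [line, pt]; ring
  · simp [line, pt]

theorem map_eq_add (hd : 3 ≤ d) (hf : f ∈ Aut (boundary (cal m d))) (x : Vertex d) :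
    f x = x + f 0 := by
  obtain ⟨o, s, hs, h⟩ := map_affine hd hf
  cases o
  · exfalso
    simp only [if_false, Bool.false_eq_true] at h
    have hj := (joined_unit (m := m) hd false 0 (a := 2) (by omega) (by omega) (by omega)).map hf
    obtain ⟨o', e, he, h'⟩ := exists_line_of_joined hd hj
    -- The vertical neighbour -(d+3) of 0 goes to f 0 - s(d+3)² = f 0 - s - s(d+3), one step in each
    -- direction; yet it must share a punctured segment with f 0.
    refine line_line_ne (by omega) (i := f 0) hs he (Eq.trans ?_ h')
    rw [h (line false 0 1)]
    simp only [line, pt, if_true, if_false, Bool.false_eq_true]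
    push_cast
    linear_combination (s : Vertex d) * mul_inv_step (d := d)
  · simp only [if_true, mul_one] at h
    rcases hs with rfl | rfl
    · rw [h x]; push_cast; ring
    · exfalso
      -- Reversal moves the puncture d to position 1, which no stiff facet allows. The images of the
      -- two ends determine the segment, and its supposed puncture j ≥ 2 turns out to be present.
      obtain ⟨t, ht, hmem⟩ := exists_stiffFacet_line (m := m) hd true (0 : Vertex d) (j := d)
        (by omega)
      obtain ⟨o', i, j, hj, hmem'⟩ := (stiffFacet_iff_line hd).1 (ht.map hf)
      obtain ⟨w, hw⟩ : ∃ w : Vertex d, w = f (line true 0 (d + 1)) := ⟨_, rfl⟩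
      have img : ∀ a : ℤ, f (line true 0 (d + 1 - a)) = line true w a := by
        intro a
        rw [hw, h, h (line true 0 (d + 1))]
        simp only [line, pt, if_true]
        push_cast
        ring
      have mem : ∀ a : ℤ, line true w a ∈ t.map f.toEmbedding ↔ line true 0 (d + 1 - a) ∈ t := by
        intro a
        rw [← img, Finset.mem_map_equiv, Equiv.symm_apply_apply]
      have m0 := (mem 0).2 ((hmem _).2 ⟨d + 1, by omega, by omega, by omega, by simp⟩)
      have m1 := (mem (d + 1)).2 ((hmem _).2 ⟨0, by omega, by omega, by omega, by simp⟩)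
      obtain ⟨a, a0, a1, aj, ea⟩ := (hmem' _).1 m0
      obtain ⟨b, b0, b1, bj, eb⟩ := (hmem' _).1 m1
      rw [line_zero] at ea
      have ei := eq_line_neg ea
      rw [ei, line_line] at eb
      obtain rfl := direction_eq eb (abs_le.2 ⟨by omega, by omega⟩)
        (abs_le.2 ⟨by omega, by omega⟩) (by omega)
      have := line_inj eb (abs_le.2 ⟨by omega, by omega⟩)
      obtain rfl : a = 0 := by omega
      rw [neg_zero, line_zero] at ei
      subst ei
      have mj := (mem j).2 ((hmem _).2 ⟨d + 1 - j, by omega, by omega, by omega, rfl⟩)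
      obtain ⟨c, c0, c1, cj, ec⟩ := (hmem' _).1 mj
      exact cj (line_inj ec (abs_le.2 ⟨by omega, by omega⟩)).symm

end Rigidity

/-! ### The surfaces on 19 vertices, d = 2 -/

section Surface

instance (m : Bool) (d : ℕ) (k a b : ℤ) : Decidable (InShape m d k a b) := by
  unfold InShape; infer_instance

instance (m : Bool) (d : ℕ) (k a b : ℤ) : Decidable (Free m d k a b) := by
  unfold Free; infer_instance

/-- The base triangles of the surface `∂𝓜³` or `∂𝓝³` on 19 vertices. -/
def baseTriangles (m : Bool) : List (List ℤ) :=
  if m then [[0, 1, 3], [0, 5, 15], [0, 3, 15], [2, 3, 15], [0, 2, 10], [2, 10, 15]]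
  else [[0, 1, 3], [0, 5, 15], [0, 3, 10], [2, 3, 10], [0, 2, 15], [2, 10, 15]]

/-- The link of the vertex `0`, an 18-cycle. -/
def linkCycle (m : Bool) (t : ℕ) : ZMod 19 :=
  ((if m then [1, 7, 3, 2, 11, 6, 18, 16, 4, 14, 8, 10, 15, 12, 13, 5, 9, 17]
  else [1, 17, 4, 14, 8, 7, 10, 15, 13, 5, 9, 16, 18, 11, 6, 2, 3, 12] : List ℕ).getD (t % 18) 0 : ℕ)

/-- The position of a vertex in the link of `0`. -/
def linkIndex (m : Bool) (x : ZMod 19) : ℕ :=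
  (if m then [1, 7, 3, 2, 11, 6, 18, 16, 4, 14, 8, 10, 15, 12, 13, 5, 9, 17]
  else [1, 17, 4, 14, 8, 7, 10, 15, 13, 5, 9, 16, 18, 11, 6, 2, 3, 12] : List ℕ).idxOf x.val

/-- Two vertices are adjacent in the link of `0`. -/
def LinkAdj (m : Bool) (y z : ZMod 19) : Prop :=
  ∃ s < 18, (y = linkCycle m s ∧ z = linkCycle m (s + 1)) ∨
    (z = linkCycle m s ∧ y = linkCycle m (s + 1))

instance (m : Bool) (y z : ZMod 19) : Decidable (LinkAdj m y z) := by
  unfold LinkAdj; infer_instance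

/-- For d = 2 the coordinates run over 0, …, 3, and (a, b) is recorded as a + 5b because d + 3 = 5.
-/
theorem base_of_free : ∀ (m : Bool) (k a b : Fin 4), Free m 2 (k : ℕ) (a : ℕ) (b : ℕ) →
    ∃ T ∈ baseTriangles m, ∀ x y : Fin 4, InShape m 2 (k : ℕ) (x : ℕ) (y : ℕ) →
      ¬ (x = a ∧ y = b) → ((x : ℕ) : ℤ) + 5 * (y : ℕ) ∈ T := by
  decide +kernel

theorem free_of_base : ∀ m : Bool, ∀ T ∈ baseTriangles m, ∃ k a b : Fin 4,
    Free m 2 (k : ℕ) (a : ℕ) (b : ℕ) ∧ ∀ r ∈ T, ∃ x y : Fin 4,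
      InShape m 2 (k : ℕ) (x : ℕ) (y : ℕ) ∧ ¬ (x = a ∧ y = b) ∧ ((x : ℕ) : ℤ) + 5 * (y : ℕ) = r := by
  decide +kernel

/-- Translating the vertex i - p of a triangle to 0 takes i - q to p - q, hence the order of the
differences. -/
theorem linkAdj_of_base : ∀ m : Bool, ∀ T ∈ baseTriangles m, ∀ p ∈ T, ∀ q ∈ T, ∀ r ∈ T,
    p ≠ q → p ≠ r → q ≠ r → LinkAdj m ((p : ZMod 19) - q) ((p : ZMod 19) - r) := by
  decide +kernel

theorem base_of_linkCycle : ∀ m : Bool, ∀ t < 18, ∃ T ∈ baseTriangles m,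
    ∃ p ∈ T, ∃ q ∈ T, ∃ r ∈ T, (p : ZMod 19) - q = linkCycle m t ∧
      (p : ZMod 19) - r = linkCycle m (t + 1) := by
  decide +kernel

theorem linkCycle_linkIndex : ∀ m : Bool, ∀ x : ZMod 19, x ≠ 0 →
    linkCycle m (linkIndex m x) = x := by
  decide +kernel

theorem linkCycle_injOn : ∀ m : Bool, ∀ s < 18, ∀ t < 18, linkCycle m s = linkCycle m t →
    s = t := by
  decide +kernel

theorem linkCycle_ne_zero_of_lt : ∀ m : Bool, ∀ s < 18, linkCycle m s ≠ 0 := by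
  decide +kernel

/-- The map fixing `0` which acts on the positions in the link by `t ↦ s + e t`. -/
def dihedral (m : Bool) (s e : ℕ) (x : ZMod 19) : ZMod 19 :=
  if x = 0 then 0 else linkCycle m (s + e * linkIndex m x)

/-- The steps 1 and 17 ≡ -1 modulo 18 are the two orientations of the cycle. The 36 dihedral
candidates are tested on the triangles around the vertex 1. -/
theorem dihedral_rigid : ∀ m : Bool, ∀ s < 18, ∀ e ∈ [1, 17],
    (∀ t < 18, LinkAdj m
      (dihedral m s e (1 + linkCycle m t) - dihedral m s e 1)
      (dihedral m s e (1 + linkCycle m (t + 1)) - dihedral m s e 1)) → s = 0 ∧ e = 1 := by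
  decide +kernel

theorem linkCycle_mod (m : Bool) (t : ℕ) : linkCycle m (t % 18) = linkCycle m t := by
  unfold linkCycle; rw [Nat.mod_mod]

theorem linkCycle_congr {m : Bool} {s t : ℕ} (h : s % 18 = t % 18) :
    linkCycle m s = linkCycle m t := by
  rw [← linkCycle_mod, h, linkCycle_mod]

theorem linkCycle_eq_iff {m : Bool} {s t : ℕ} :
    linkCycle m s = linkCycle m t ↔ s % 18 = t % 18 := by
  refine ⟨fun h => ?_, linkCycle_congr⟩
  rw [← linkCycle_mod m s, ← linkCycle_mod m t] at h
  exact linkCycle_injOn m _ (Nat.mod_lt _ (by norm_num)) _ (Nat.mod_lt _ (by norm_num)) h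

theorem linkCycle_ne_zero (m : Bool) (t : ℕ) : linkCycle m t ≠ 0 := by
  rw [← linkCycle_mod]
  exact linkCycle_ne_zero_of_lt m _ (Nat.mod_lt _ (by norm_num))

theorem LinkAdj.eq_or {m : Bool} {t : ℕ} {z : ZMod 19} (h : LinkAdj m (linkCycle m t) z) :
    z = linkCycle m (t + 1) ∨ z = linkCycle m (t + 17) := by
  obtain ⟨s, -, ⟨h1, rfl⟩ | ⟨rfl, h1⟩⟩ := h <;> rw [linkCycle_eq_iff] at h1
  · left; apply linkCycle_congr; omega
  · right; apply linkCycle_congr; omega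

/-- Rigidity of the triangulated surface with the links `linkCycle`. -/
theorem surface_rigid {m : Bool} {g : ZMod 19 → ZMod 19} (hg : Function.Injective g)
    (h0 : g 0 = 0) (h : ∀ x t, LinkAdj m (g (x + linkCycle m t) - g x)
      (g (x + linkCycle m (t + 1)) - g x)) (x : ZMod 19) : g x = x := by
  have hadj : ∀ t, LinkAdj m (g (linkCycle m t)) (g (linkCycle m (t + 1))) := by
    intro t
    simpa [h0] using h 0 t
  obtain ⟨s, hs, hgs⟩ : ∃ s < 18, g (linkCycle m 0) = linkCycle m s := by
    obtain ⟨s, hs, h1 | h1⟩ := hadj 0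
    · exact ⟨s, hs, h1.1⟩
    · exact ⟨(s + 1) % 18, Nat.mod_lt _ (by norm_num), by rw [h1.2, linkCycle_mod]⟩
  obtain ⟨e, he, hge⟩ : ∃ e, e ∈ [1, 17] ∧ g (linkCycle m 1) = linkCycle m (s + e) := by
    have := hadj 0
    rw [hgs] at this
    rcases this.eq_or with h1 | h1
    · exact ⟨1, by simp, h1⟩
    · exact ⟨17, by simp, h1⟩
  have he' : e = 1 ∨ e = 17 := by simpa using he
  have all : ∀ t, g (linkCycle m t) = linkCycle m (s + e * t) ∧
      g (linkCycle m (t + 1)) = linkCycle m (s + e * (t + 1)) := by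
    intro t
    induction t with
    | zero => exact ⟨by simpa using hgs, by simpa using hge⟩
    | succ t ih =>
      refine ⟨ih.2, ?_⟩
      -- By injectivity the image walk never turns back, so its first step determines it.
      have hne : g (linkCycle m (t + 1 + 1)) ≠ g (linkCycle m t) := by
        intro hc
        have := linkCycle_eq_iff.1 (hg hc)
        omega
      have := hadj (t + 1)
      rw [ih.2] at this
      rw [ih.1] at hne
      rcases he' with rfl | rfl <;> rcases this.eq_or with h1 | h1 <;> rw [h1] at hne ⊢
      · apply linkCycle_congr; omega
      · exact absurd (linkCycle_congr (by omega)) hne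
      · exact absurd (linkCycle_congr (by omega)) hne
      · apply linkCycle_congr; omega
  have hdi : ∀ y, g y = dihedral m s e y := by
    intro y
    unfold dihedral
    split_ifs with hy
    · rw [hy, h0]
    · rw [← (all _).1, linkCycle_linkIndex m y hy]
  obtain ⟨rfl, rfl⟩ := dihedral_rigid m s hs e he fun t _ => by
    simp only [← hdi]; exact h 1 t
  by_cases hx : x = 0
  · rw [hx, h0]
  · have := (all (linkIndex m x)).1
    rwa [zero_add, one_mul, linkCycle_linkIndex m x hx] at this

/-- A face containing three given vertices, when `d = 2`. -/
theorem exists_face_iff {m : Bool} {x y z : Vertex 2} :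
    (∃ s ∈ (boundary (cal m 2)).faces, x ∈ s ∧ y ∈ s ∧ z ∈ s) ↔
      ∃ (i : Vertex 2), ∃ T ∈ baseTriangles m, ∃ p ∈ T, ∃ q ∈ T, ∃ r ∈ T,
        x = i - (p : ℤ) ∧ y = i - (q : ℤ) ∧ z = i - (r : ℤ) := by
  have hpt : ∀ (i : Vertex 2) (a b : ℤ), pt i a b = i - ((a + 5 * b : ℤ) : Vertex 2) := by
    intro i a b
    unfold pt
    push_cast
    ring
  constructor
  · rintro ⟨s, hs, hx, hy, hz⟩
    obtain ⟨_, k, i, a, b, k0, k1, hf, hsub⟩ := (mem_faces_boundary_iff le_rfl).1 hs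
    have hb := hf.1.bounds
    push_cast at hb k1
    lift k to ℕ using k0
    lift a to ℕ using hb.1
    lift b to ℕ using hb.2.2.1
    obtain ⟨T, hT, hcov⟩ := base_of_free m ⟨k, by omega⟩ ⟨a, by omega⟩ ⟨b, by omega⟩ hf
    have key : ∀ w ∈ s, ∃ p ∈ T, w = i - ((p : ℤ) : Vertex 2) := by
      intro w hw
      obtain ⟨hne, hw⟩ := Finset.mem_erase.1 (hsub hw)
      obtain ⟨u, v, huv, rfl⟩ := mem_fac.1 hw
      have hb' := huv.bounds
      push_cast at hb'
      lift u to ℕ using hb'.1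
      lift v to ℕ using hb'.2.2.1
      refine ⟨_, hcov ⟨u, by omega⟩ ⟨v, by omega⟩ huv ?_, hpt _ _ _⟩
      rintro ⟨h1, h2⟩
      rw [Fin.mk.injEq] at h1 h2
      exact hne (by rw [h1, h2])
    obtain ⟨p, hp, hx⟩ := key x hx
    obtain ⟨q, hq, hy⟩ := key y hy
    obtain ⟨r, hr, hz⟩ := key z hz
    exact ⟨i, T, hT, p, hp, q, hq, r, hr, hx, hy, hz⟩
  · rintro ⟨i, T, hT, p, hp, q, hq, r, hr, rfl, rfl, rfl⟩
    obtain ⟨k, a, b, hf, h⟩ := free_of_base m T hT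
    have key : ∀ p ∈ T, i - ((p : ℤ) : Vertex 2) ∈ (fac m k i).erase (pt i (a : ℕ) (b : ℕ)) := by
      intro p hp
      obtain ⟨x, y, hs, hne, rfl⟩ := h p hp
      rw [← hpt]
      refine pt_mem_erase i hs hf.1 fun e => hne ⟨Fin.ext ?_, Fin.ext ?_⟩
      · exact_mod_cast e.1
      · exact_mod_cast e.2
    exact ⟨_, erase_mem_faces le_rfl (by omega) (by have := k.2; push_cast; omega) hf i, key p hp,
      key q hq, key r hr⟩

theorem map_eq_add_of_surface {m : Bool} {f : Equiv.Perm (Vertex 2)}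
    (hf : f ∈ Aut (boundary (cal m 2))) (x : Vertex 2) : f x = x + f 0 := by
  have key := surface_rigid (m := m) (g := fun x : Vertex 2 => f x - f 0)
    (fun x y h => f.injective (sub_left_injective h)) (sub_self _) (fun x t => ?_) x
  · exact sub_eq_iff_eq_add.1 key
  · obtain ⟨T, hT, p, hp, q, hq, r, hr, e1, e2⟩ := base_of_linkCycle m (t % 18)
      (Nat.mod_lt _ (by norm_num))
    rw [linkCycle_mod] at e1
    rw [linkCycle_congr (show (t % 18 + 1) % 18 = (t + 1) % 18 by omega)] at e2
    obtain ⟨s, hs, h0, h1, h2⟩ := exists_face_iff.2 ⟨x + (p : ℤ), T, hT, p, hp, q, hq, r, hr,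
      rfl, rfl, rfl⟩
    obtain ⟨j, T', hT', p', hp', q', hq', r', hr', g0, g1, g2⟩ := exists_face_iff.1
      ⟨_, (map_face hf).2 hs, Finset.mem_map_of_mem _ h0, Finset.mem_map_of_mem _ h1,
        Finset.mem_map_of_mem _ h2⟩
    have i0 : x + ((p : ℤ) : Vertex 2) - ((p : ℤ) : Vertex 2) = x := add_sub_cancel_right _ _
    have i1 : x + ((p : ℤ) : Vertex 2) - ((q : ℤ) : Vertex 2) = x + linkCycle m t :=
      (add_sub_assoc _ _ _).trans (congrArg (x + ·) e1)
    have i2 : x + ((p : ℤ) : Vertex 2) - ((r : ℤ) : Vertex 2) = x + linkCycle m (t + 1) :=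
      (add_sub_assoc _ _ _).trans (congrArg (x + ·) e2)
    rw [i0] at g0
    rw [i1] at g1
    rw [i2] at g2
    change f _ = _ at g0 g1 g2
    have npq : p' ≠ q' := by
      rintro rfl
      have := f.injective (g0.trans g1.symm)
      exact linkCycle_ne_zero m t (left_eq_add.1 this)
    have npr : p' ≠ r' := by
      rintro rfl
      have := f.injective (g0.trans g2.symm)
      exact linkCycle_ne_zero m (t + 1) (left_eq_add.1 this)
    have nqr : q' ≠ r' := by
      rintro rfl
      have := linkCycle_eq_iff.1 (add_left_cancel (f.injective (g1.trans g2.symm)))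
      omega
    have := linkAdj_of_base m T' hT' p' hp' q' hq' r' hr' npq npr nqr
    have d1 : f (x + linkCycle m t) - f 0 - (f x - f 0) =
        ((p' : ℤ) : Vertex 2) - ((q' : ℤ) : Vertex 2) := by rw [g0, g1]; ring
    have d2 : f (x + linkCycle m (t + 1)) - f 0 - (f x - f 0) =
        ((p' : ℤ) : Vertex 2) - ((r' : ℤ) : Vertex 2) := by rw [g0, g2]; ring
    exact d1 ▸ d2 ▸ this

end Surface

/-! ### The automorphism groups and the order of ψ -/

section Main

variable {d : ℕ}

theorem psi_pow (k : ℕ) : psi d ^ k = Equiv.addRight (k : Vertex d) := by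
  induction k with
  | zero => ext x; simp
  | succ k ih =>
    rw [pow_succ, ih]
    ext x
    simp only [psi, Equiv.Perm.mul_apply, Equiv.coe_addRight]
    push_cast
    ring

theorem addRight_mem_zpowers (c : Vertex d) : Equiv.addRight c ∈ Subgroup.zpowers (psi d) := by
  refine Subgroup.mem_zpowers_iff.2 ⟨(c.val : ℤ), ?_⟩
  rw [zpow_natCast, psi_pow, ZMod.natCast_val, ZMod.cast_id', id]

theorem aut_boundary_cal_le (m : Bool) (hd : 2 ≤ d) :
    Aut (boundary (cal m d)) ≤ Subgroup.zpowers (psi d) := by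
  intro f hf
  have h : ∀ x, f x = x + f 0 := by
    rcases hd.eq_or_lt with rfl | h3
    · exact map_eq_add_of_surface hf
    · exact map_eq_add h3 hf
  have : f = Equiv.addRight (f 0) := Equiv.ext h
  rw [this]
  exact addRight_mem_zpowers _

theorem aut_cal (m : Bool) (hd : 2 ≤ d) : Aut (cal m d) = Subgroup.zpowers (psi d) :=
  ((aut_le_aut_boundary (singleton_mem_faces_boundary hd)).trans
    (aut_boundary_cal_le m hd)).antisymm
    ((Subgroup.zpowers_le).2 (translation_mem_aut hd 1))

theorem aut_boundary_cal (m : Bool) (hd : 2 ≤ d) :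
    Aut (boundary (cal m d)) = Subgroup.zpowers (psi d) :=
  (aut_boundary_cal_le m hd).antisymm
    ((aut_cal m hd).ge.trans (aut_le_aut_boundary (singleton_mem_faces_boundary hd)))

theorem orderOf_psi : orderOf (psi d) = vertexCount d := by
  refine (orderOf_eq_iff (NeZero.pos _)).2 ⟨?_, fun k hk h0 h => ?_⟩
  · rw [psi_pow, CharP.cast_eq_zero]
    ext x; simp
  · rw [psi_pow] at h
    have := congrArg (fun g : Equiv.Perm (Vertex d) => g 0) h
    simp only [Equiv.coe_addRight, zero_add, Equiv.Perm.coe_one, id] at this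
    rw [ZMod.natCast_eq_zero_iff] at this
    exact absurd (Nat.le_of_dvd h0 this) (by omega)

end Main

end CyclicManifold

theorem mainTheorem5 (d : ℕ) (hd : 2 ≤ d) :
    CyclicManifold.Aut (CyclicManifold.bdM d) = Subgroup.zpowers (CyclicManifold.psi d) ∧
    CyclicManifold.Aut (CyclicManifold.calM d) = Subgroup.zpowers (CyclicManifold.psi d) ∧
    CyclicManifold.Aut (CyclicManifold.calN d) = Subgroup.zpowers (CyclicManifold.psi d) ∧
    CyclicManifold.Aut (CyclicManifold.bdN d) = Subgroup.zpowers (CyclicManifold.psi d) ∧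
    Nonempty (Subgroup.zpowers (CyclicManifold.psi d) ≃*
      Multiplicative (ZMod (CyclicManifold.vertexCount d))) := by
  have hM : CyclicManifold.calM d = CyclicManifold.cal true d := by
    rw [CyclicManifold.calM, CyclicManifold.facetsM_eq, CyclicManifold.cal]
  have hN : CyclicManifold.calN d = CyclicManifold.cal false d := by
    rw [CyclicManifold.calN, CyclicManifold.facetsN_eq, CyclicManifold.cal]
  rw [CyclicManifold.bdM, CyclicManifold.bdN, hM, hN]
  refine ⟨CyclicManifold.aut_boundary_cal true hd, CyclicManifold.aut_cal true hd,
    CyclicManifold.aut_cal false hd, CyclicManifold.aut_boundary_cal false hd, ?_⟩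
  have hcard : Nat.card (Subgroup.zpowers (CyclicManifold.psi d)) =
      CyclicManifold.vertexCount d := by
    rw [Nat.card_zpowers, CyclicManifold.orderOf_psi]
  rw [← hcard]
  exact ⟨(zmodCyclicMulEquiv inferInstance).symm⟩
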